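/- For a positive integer $n$, let $\mathcal{A}_n$ be the family of all arithmetic progressions in $\mathbb{Z}_n=\mathbb{Z}/n\mathbb{Z}$, that is, of all sets $\{a+kd : 0\le k<l\}$ with $a,d\in\mathbb{Z}_n$ and $l\ge 0$ an integer. For a family $\mathcal{A}$ of subsets of a finite set $\Omega$, let $$\operatorname{disc}(\mathcal{A})=\min_{\chi:\Omega\to\{1,-1\}}\ \max_{A\in\mathcal{A}}\Big|\sum_{x\in A}\chi(x)\Big|,\qquad \operatorname{herdisc}(\mathcal{A})=\max_{X\subseteq\Omega}\operatorname{disc}(\mathcal{A}|_X),$$ where $\mathcal{A}|_X=\{A\cap X : A\in\mathcal{A}\}$ is regarded as a family of subsets of the ground set $X$. Let $\phi$ be Euler's totient function and $\log$ the natural logarithm. Theorem. There exists an absolute constant $c$ such that, for all positive integers $n$, $$\operatorname{herdisc}(\mathcal{A}_n)\le c\,\phi(n)^{1/2}\left(\log\frac{en}{\phi(n)}\right)^{3/2}.$$ -/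

import Mathlib

/-- `χ(A) = ∑_{x ∈ A} χ(x)` for a two-coloring `χ : Ω → {1, -1}`; the type `ℤˣ` of units of `ℤ` is
exactly `{1, -1}`. -/
def colorSum {Ω : Type*} (χ : Ω → ℤˣ) (A : Finset Ω) : ℤ :=
  ∑ x ∈ A, (χ x : ℤ)

/-- The discrepancy `min_χ max_{A ∈ 𝒜} |χ(A)|` of a family `𝒜` of subsets of a finite set `Ω`,
the minimum being over all two-colorings `χ` of `Ω`. -/
def disc {Ω : Type*} [Fintype Ω] [DecidableEq Ω] (𝒜 : Finset (Finset Ω)) : ℕ :=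
  (Finset.univ : Finset (Ω → ℤˣ)).inf' Finset.univ_nonempty
    (fun χ => 𝒜.sup (fun A => (colorSum χ A).natAbs))

/-- The restriction `𝒜|_X = {A ∩ X : A ∈ 𝒜}`, a family of subsets of the ground set `X`. -/
def restrictFamily {Ω : Type*} [DecidableEq Ω] (𝒜 : Finset (Finset Ω)) (X : Finset Ω) :
    Finset (Finset {x // x ∈ X}) :=
  𝒜.image (fun A => A.subtype (fun x => x ∈ X))

/-- The hereditary discrepancy `max_{X ⊆ Ω} disc(𝒜|_X)`. -/
def herdisc {Ω : Type*} [Fintype Ω] [DecidableEq Ω] (𝒜 : Finset (Finset Ω)) : ℕ :=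
  (Finset.univ : Finset (Finset Ω)).sup (fun X => disc (restrictFamily 𝒜 X))

/-- The arithmetic progression `{a + k d : 0 ≤ k < l}` in `ℤ/nℤ`, as a set. -/
def modAP {n : ℕ} (a d : ZMod n) (l : ℕ) : Finset (ZMod n) :=
  (Finset.range l).image (fun k : ℕ => a + (k : ZMod n) * d)

open Classical in
/-- The family of all arithmetic progressions in `ℤ/nℤ`, for `n` positive. -/
noncomputable def modAPs (n : ℕ) [NeZero n] : Finset (Finset (ZMod n)) :=
  Finset.univ.filter (fun A => ∃ (a d : ZMod n) (l : ℕ), A = modAP a d l)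

/-! The proof is the partial colouring method, with code lengths in place of entropy. For a family
of sets with prescribed bounds `Δ j`, round each sum to a multiple of `2 * Δ j`. If the roundings
have short codes on average, exponentially many colourings share all of them, so two of these differ
on at least a tenth of `X`, and half their difference is a partial colouring meeting every bound
(`exists_partial_coloring`).

For progressions it suffices to control blocks. For each difference `d`, list the points of `X` in
each coset of `⟨d⟩` along `d`; in base 16, a prefix of the list is a union of at most 15 blocks of
each length `16 ^ i`. Such blocks exist only if `d` has order at least `16 ^ i`, at most `#X / 16 ^
i` of them per `d`, and at most `4 φ(n) (1 + log (n / 16 ^ i))` differences qualify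
(`card_addOrderOf_ge_le`).

Put `L = log (e n / φ(n))` and choose `16 ^ q` of order `φ(n) L`. There are then `O(#X)` blocks of
length `16 ^ q`, and bounds of order `4 ^ q * 2 ^ (-|i - q|)` at level `i` are affordable
(`level_cost_le`). Each round thus costs `O(4 ^ q) = O((φ(n) L) ^ (1/2))`. Boundedly many rounds
shrink the uncoloured set by 16. Sizes below `16 ^ q` contribute a geometric series, and the `O(L)`
scales above it contribute `O(4 ^ q)` each, for a total of `O(φ(n) ^ (1/2) * L ^ (3/2))`. -/

/-! ### Partial colouring by counting code lengths. -/

open Finset in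
/-- Pigeonhole principle with code lengths: if the observations `b j` have code lengths `w j`
satisfying Kraft's inequality and average total length at most `V`, then some fibre of the joint
observation is large. -/
theorem exists_large_fiber {Ω ι : Type*} [Fintype Ω] [DecidableEq Ω] [Nonempty Ω] [Fintype ι]
    [DecidableEq ι] (b : ι → Ω → ℤ) (w : ι → ℤ → ℝ) (hw : ∀ j k, 0 ≤ w j k)
    (kraft : ∀ j (T : Finset ℤ), ∑ k ∈ T, Real.exp (-w j k) ≤ 1) {V : ℝ} (hV : 0 < V)
    (hcost : ∑ j, ∑ ω, w j (b j ω) ≤ V * Fintype.card Ω) :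
    ∃ ω₀, (Fintype.card Ω : ℝ) ≤
      2 * Real.exp (2 * V) * #{ω | ∀ j, b j ω = b j ω₀} := by
  classical
  by_contra! hcon
  set good : Finset Ω := {ω | ∑ j, w j (b j ω) ≤ 2 * V} with hgood
  have hΩ : (0 : ℝ) < Fintype.card Ω := by exact_mod_cast Fintype.card_pos
  -- Markov: at least half of `Ω` has total code length at most `2 * V`.
  have hmarkov : (Fintype.card Ω : ℝ) ≤ 2 * #good := by
    have h1 : (2 * V) * #(goodᶜ) ≤ V * Fintype.card Ω := by
      calc (2 * V) * #(goodᶜ) = ∑ ω ∈ goodᶜ, 2 * V := by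
            rw [sum_const, nsmul_eq_mul, mul_comm]
        _ ≤ ∑ ω ∈ goodᶜ, ∑ j, w j (b j ω) := by
            refine sum_le_sum fun ω hω => ?_
            simp only [hgood, mem_compl, mem_filter, mem_univ, true_and, not_le] at hω
            exact hω.le
        _ ≤ ∑ ω, ∑ j, w j (b j ω) :=
            sum_le_sum_of_subset_of_nonneg (subset_univ _)
              fun ω _ _ => sum_nonneg fun j _ => hw j _
        _ ≤ _ := by rw [sum_comm]; exact hcost
    have h2 : (#good : ℝ) + #(goodᶜ) = Fintype.card Ω := by
      exact_mod_cast card_add_card_compl good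
    nlinarith
  let β : Ω → ι → ℤ := fun ω j => b j ω
  -- Kraft's inequality multiplies over `j`, while each vector observed on `good` contributes at
  -- least `exp (-2V)` to the product.
  have himage : (#(good.image β) : ℝ) ≤ Real.exp (2 * V) := by
    have h1 : ∑ f ∈ Fintype.piFinset (fun j => univ.image (b j)), ∏ j, Real.exp (-w j (f j)) ≤ 1 := by
      rw [← prod_univ_sum (fun j => univ.image (b j)) (fun j k => Real.exp (-w j k))]
      exact prod_le_one (fun j _ => sum_nonneg fun k _ => (Real.exp_pos _).le)
        (fun j _ => kraft j _)
    have h2 : #(good.image β) * Real.exp (-(2 * V)) ≤ 1 := by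
      calc #(good.image β) * Real.exp (-(2 * V))
          = ∑ f ∈ good.image β, Real.exp (-(2 * V)) := by rw [sum_const, nsmul_eq_mul]
        _ ≤ ∑ f ∈ good.image β, ∏ j, Real.exp (-w j (f j)) := by
            refine sum_le_sum fun f hf => ?_
            obtain ⟨ω, hω, rfl⟩ := mem_image.1 hf
            rw [← Real.exp_sum, Real.exp_le_exp, sum_neg_distrib, neg_le_neg_iff]
            simpa [hgood] using hω
        _ ≤ ∑ f ∈ Fintype.piFinset (fun j => univ.image (b j)), ∏ j, Real.exp (-w j (f j)) := by
            refine sum_le_sum_of_subset_of_nonneg ?_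
              fun f _ _ => prod_nonneg fun j _ => (Real.exp_pos _).le
            intro f hf
            obtain ⟨ω, hω, rfl⟩ := mem_image.1 hf
            exact Fintype.mem_piFinset.2 fun j => mem_image_of_mem _ (mem_univ _)
        _ ≤ 1 := h1
    rw [Real.exp_neg, ← div_eq_mul_inv, div_le_one (Real.exp_pos _)] at h2
    exact h2
  have hne : (good.image β).Nonempty := by
    rw [image_nonempty, ← card_pos]
    have : (0 : ℝ) < #good := by linarith
    exact_mod_cast this
  have hsum : (#good : ℝ) * (2 * Real.exp (2 * V)) <
      #(good.image β) * Fintype.card Ω := by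
    rw [card_eq_sum_card_image β good]
    push_cast
    rw [sum_mul, ← nsmul_eq_mul, ← sum_const]
    refine sum_lt_sum_of_nonempty hne fun f hf => ?_
    obtain ⟨ω, hω, rfl⟩ := mem_image.1 hf
    refine lt_of_le_of_lt ?_ (hcon ω)
    rw [mul_comm]
    refine mul_le_mul_of_nonneg_left ?_ (by positivity)
    refine Nat.cast_le.2 (card_le_card fun ω' hω' => ?_)
    simp only [mem_filter, mem_univ, true_and] at hω' ⊢
    exact fun j => congrFun hω'.2 j
  have := Real.exp_pos (2 * V)
  nlinarith

-- Chernoff bound: give each disagreement on `X` the weight `exp (-2)`. The total weight factors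
-- over points, and a colouring with fewer than `#X / 10` disagreements has weight at least `exp
-- (-#X / 5)`.
open Finset in
theorem card_near_le {α : Type*} [Fintype α] [DecidableEq α] (X : Finset α) (χ₀ : α → ℤˣ) :
    (#{χ : α → ℤˣ | 10 * #{x ∈ X | χ₀ x ≠ χ x} < #X} : ℝ) ≤
      2 ^ Fintype.card α * ((1 + Real.exp (-2)) / 2 * Real.exp (1 / 5)) ^ #X := by
  have hprod : ∑ χ : α → ℤˣ, ∏ x, (if x ∈ X ∧ χ₀ x ≠ χ x then Real.exp (-2) else 1) =
      2 ^ Fintype.card α * ((1 + Real.exp (-2)) / 2) ^ #X := by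
    rw [← Fintype.piFinset_univ,
      ← prod_univ_sum (fun _ => univ)
        (fun x (u : ℤˣ) => if x ∈ X ∧ χ₀ x ≠ u then Real.exp (-2) else 1)]
    have : ∀ x, ∑ u : ℤˣ, (if x ∈ X ∧ χ₀ x ≠ u then Real.exp (-2) else 1) =
        2 * (if x ∈ X then (1 + Real.exp (-2)) / 2 else 1) := by
      intro x
      rw [show (univ : Finset ℤˣ) = {1, -1} from rfl, sum_pair (by decide)]
      by_cases hx : x ∈ X
      · rcases Int.units_eq_one_or (χ₀ x) with h | h
        · simp [hx, h]; ring
        · simp [hx, h]; ring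
      · simp [hx]; norm_num
    rw [prod_congr rfl fun x _ => this x, prod_mul_distrib, prod_const, card_univ]
    congr 1
    rw [prod_ite_mem, univ_inter, prod_const]
  have hpt : ∀ χ ∈ ({χ : α → ℤˣ | 10 * #{x ∈ X | χ₀ x ≠ χ x} < #X} : Finset (α → ℤˣ)),
      1 ≤ Real.exp (1 / 5) ^ #X *
        ∏ x, (if x ∈ X ∧ χ₀ x ≠ χ x then Real.exp (-2) else 1) := by
    intro χ hχ
    rw [mem_filter] at hχ
    have h1 : (10 * #{x ∈ X | χ₀ x ≠ χ x} : ℝ) ≤ #X := by exact_mod_cast hχ.2.le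
    have h2 : ∏ x, (if x ∈ X ∧ χ₀ x ≠ χ x then Real.exp (-2) else 1) =
        Real.exp (-2) ^ #{x ∈ X | χ₀ x ≠ χ x} := by
      rw [← prod_filter, prod_const]
      congr 2
      ext x
      simp
    rw [h2, ← Real.exp_nat_mul, ← Real.exp_nat_mul, ← Real.exp_add]
    apply Real.one_le_exp
    linarith
  calc _ = ∑ χ ∈ ({χ : α → ℤˣ | 10 * #{x ∈ X | χ₀ x ≠ χ x} < #X} : Finset (α → ℤˣ)), (1 : ℝ) := by
        simp
    _ ≤ _ := sum_le_sum hpt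
    _ ≤ ∑ χ : α → ℤˣ, Real.exp (1 / 5) ^ #X *
        ∏ x, (if x ∈ X ∧ χ₀ x ≠ χ x then Real.exp (-2) else 1) := by
        refine sum_le_sum_of_subset_of_nonneg (subset_univ _) fun χ _ _ => ?_
        refine mul_nonneg (by positivity) (prod_nonneg fun x _ => ?_)
        split_ifs <;> positivity
    _ = _ := by
        rw [← mul_sum, hprod, mul_pow]
        ring

-- Bound `e^|x|` by `e^x + e^(-x)`; each moment generating function factors into `cosh θ ≤ exp (θ² /
-- 2)` with `θ = ±1 / √#B`.
open Finset in
theorem sum_exp_abs_colorSum_le {α : Type*} [Fintype α] [DecidableEq α] {B : Finset α}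
    (hB : B.Nonempty) :
    ∑ χ : α → ℤˣ, Real.exp (|(colorSum χ B : ℝ)| / √(#B)) ≤ 4 * 2 ^ Fintype.card α := by
  have hs : (0 : ℝ) < #B := by exact_mod_cast hB.card_pos
  have key : ∀ θ : ℝ, θ ^ 2 * #B = 1 →
      ∑ χ : α → ℤˣ, Real.exp (θ * colorSum χ B) ≤ 2 * 2 ^ Fintype.card α := by
    intro θ hθ
    have h1 : ∀ χ : α → ℤˣ, Real.exp (θ * colorSum χ B) =
        ∏ x, (if x ∈ B then Real.exp (θ * ((χ x : ℤ) : ℝ)) else 1) := by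
      intro χ
      rw [prod_ite_mem, univ_inter, ← Real.exp_sum, ← mul_sum, colorSum]
      push_cast
      rfl
    rw [sum_congr rfl fun χ _ => h1 χ, ← Fintype.piFinset_univ,
      ← prod_univ_sum (fun _ => univ)
        (fun x (u : ℤˣ) => if x ∈ B then Real.exp (θ * ((u : ℤ) : ℝ)) else 1)]
    have h2 : ∀ x, ∑ u : ℤˣ, (if x ∈ B then Real.exp (θ * ((u : ℤ) : ℝ)) else 1) =
        2 * (if x ∈ B then Real.cosh θ else 1) := by
      intro x
      rw [show (univ : Finset ℤˣ) = {1, -1} from rfl, sum_pair (by decide)]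
      by_cases hx : x ∈ B
      · simp [hx, Real.cosh_eq]; ring
      · simp [hx]; norm_num
    rw [prod_congr rfl fun x _ => h2 x, prod_mul_distrib, prod_const, card_univ,
      prod_ite_mem, univ_inter, prod_const, mul_comm]
    refine mul_le_mul_of_nonneg_right ?_ (by positivity)
    calc Real.cosh θ ^ #B ≤ Real.exp (θ ^ 2 / 2) ^ #B :=
          pow_le_pow_left₀ (Real.cosh_pos _).le (Real.cosh_le_exp_half_sq θ) _
      _ = Real.exp (1 / 2) := by
          rw [← Real.exp_nat_mul]; congr 1; linarith
      _ ≤ 2 := by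
          rw [← Real.le_log_iff_exp_le (by norm_num)]
          linarith [Real.log_two_gt_d9]
  have hsq : √(#B : ℝ) ^ 2 = #B := Real.sq_sqrt hs.le
  have hsp : 0 < √(#B : ℝ) := Real.sqrt_pos.2 hs
  calc ∑ χ : α → ℤˣ, Real.exp (|(colorSum χ B : ℝ)| / √(#B))
      ≤ ∑ χ : α → ℤˣ, (Real.exp ((1 / √(#B)) * colorSum χ B) +
          Real.exp ((-(1 / √(#B))) * colorSum χ B)) := by
        refine sum_le_sum fun χ _ => ?_
        rcases abs_cases (colorSum χ B : ℝ) with ⟨h, _⟩ | ⟨h, _⟩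
        · rw [h, div_eq_inv_mul, one_div]
          linarith [Real.exp_pos ((-(√(#B : ℝ))⁻¹) * colorSum χ B)]
        · rw [h, div_eq_inv_mul, one_div, mul_neg, ← neg_mul]
          linarith [Real.exp_pos (((√(#B : ℝ))⁻¹) * colorSum χ B)]
    _ ≤ 2 * 2 ^ Fintype.card α + 2 * 2 ^ Fintype.card α := by
        rw [sum_add_distrib]
        refine add_le_add (key _ ?_) (key _ ?_)
        · rw [div_pow, hsq]; field_simp
        · rw [neg_sq, div_pow, hsq]; field_simp
    _ = _ := by ring

open Finset in
theorem sum_geometric_weight (ε : ℝ) (N : ℕ) :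
    ∑ k ∈ Icc (-(N : ℤ)) N, (if k = 0 then 1 - ε else ε * (1 / 3) ^ k.natAbs) =
      1 - ε * (1 / 3) ^ N := by
  induction N with
  | zero => simp
  | succ N ih =>
    have h : Icc (-((N + 1 : ℕ) : ℤ)) ((N + 1 : ℕ) : ℤ) =
        insert (-((N + 1 : ℕ) : ℤ)) (insert ((N + 1 : ℕ) : ℤ) (Icc (-(N : ℤ)) N)) := by
      ext k
      simp only [mem_insert, mem_Icc]
      omega
    rw [h, sum_insert, sum_insert, ih, if_neg (by omega), if_neg (by omega), Int.natAbs_neg,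
      Int.natAbs_natCast]
    · ring
    · simp only [mem_Icc]; omega
    · simp only [mem_insert, mem_Icc]; omega

-- The Shannon code of the law with mass `1 - ε` at 0 and `ε * 3 ^ (-|k|)` elsewhere, which has
-- total mass 1. A small `ε` makes the value 0 nearly free.
open Finset in
theorem exists_code_length {ε : ℝ} (h0 : 0 < ε) (h1 : ε ≤ 1 / 2) :
    ∃ w : ℤ → ℝ, (∀ k, 0 ≤ w k) ∧ (∀ T : Finset ℤ, ∑ k ∈ T, Real.exp (-w k) ≤ 1) ∧
      w 0 ≤ 2 * ε ∧ ∀ k, k ≠ 0 → w k ≤ -Real.log ε + 2 * |(k : ℝ)| := by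
  let p : ℤ → ℝ := fun k => if k = 0 then 1 - ε else ε * (1 / 3) ^ k.natAbs
  have hp : ∀ k, 0 < p k := by
    intro k
    simp only [p]
    split_ifs
    · linarith
    · positivity
  have hp1 : ∀ k, p k ≤ 1 := by
    intro k
    simp only [p]
    split_ifs
    · linarith
    · have : (1 / 3 : ℝ) ^ k.natAbs ≤ 1 := pow_le_one₀ (by norm_num) (by norm_num)
      nlinarith
  refine ⟨fun k => -Real.log (p k), fun k => ?_, fun T => ?_, ?_, fun k hk => ?_⟩
  · have := Real.log_nonpos (hp k).le (hp1 k)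
    linarith
  · calc ∑ k ∈ T, Real.exp (-(-Real.log (p k))) = ∑ k ∈ T, p k :=
          sum_congr rfl fun k _ => by rw [neg_neg, Real.exp_log (hp k)]
      _ ≤ ∑ k ∈ Icc (-((T.sup Int.natAbs : ℕ) : ℤ)) (T.sup Int.natAbs : ℕ), p k := by
          refine sum_le_sum_of_subset_of_nonneg (fun k hk => ?_) fun k _ _ => (hp k).le
          have := le_sup (f := Int.natAbs) hk
          rw [mem_Icc]
          omega
      _ ≤ 1 := by
          rw [sum_geometric_weight]
          have : 0 ≤ ε * (1 / 3) ^ (T.sup Int.natAbs) := by positivity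
          linarith
  · have h2 := Real.one_sub_inv_le_log_of_pos (show 0 < 1 - ε by linarith)
    have h3 : (1 - ε)⁻¹ ≤ 1 + 2 * ε := by
      rw [inv_le_iff_one_le_mul₀ (by linarith)]
      nlinarith
    simp only [p, if_true]
    linarith
  · simp only [p, if_neg hk]
    rw [Real.log_mul h0.ne' (by positivity), Real.log_pow, one_div, Real.log_inv]
    have h2 : Real.log 3 ≤ 2 := by
      have := Real.log_le_sub_one_of_pos (show (0 : ℝ) < 3 by norm_num)
      linarith
    have h3 : ((k.natAbs : ℕ) : ℝ) = |(k : ℝ)| := by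
      rw [Nat.cast_natAbs, Int.cast_abs]
    rw [h3]
    nlinarith [abs_nonneg (k : ℝ)]

/-- The factor `exp (|c| / s)` is what `sum_exp_abs_colorSum_le` averages when `s = √#B`. The sixth
power, for `s ≤ Δ`, is chosen to outweigh the number of short blocks. -/
theorem exists_rounding_weight {Δ s : ℝ} (hΔ : 0 < Δ) (hs : 0 < s) :
    ∃ w : ℤ → ℝ, (∀ k, 0 ≤ w k) ∧ (∀ T : Finset ℤ, ∑ k ∈ T, Real.exp (-w k) ≤ 1) ∧
      ∀ c : ℝ, w ⌊(c + Δ) / (2 * Δ)⌋ ≤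
        50000 * min (s / Δ) ((s / Δ) ^ 6) * Real.exp (|c| / s) := by
  set v := s / Δ with hv
  have hvpos : 0 < v := div_pos hs hΔ
  have hround : ∀ c : ℝ, |((⌊(c + Δ) / (2 * Δ)⌋ : ℤ) : ℝ)| ≤ |c| / s * v / 2 + 1 / 2 := by
    intro c
    have e1 : |c| / s * v / 2 = |c| / (2 * Δ) := by rw [hv]; field_simp
    have e2 : (c + Δ) / (2 * Δ) = c / (2 * Δ) + 1 / 2 := by field_simp
    have h1 := Int.floor_le ((c + Δ) / (2 * Δ))
    have h2 := Int.lt_floor_add_one ((c + Δ) / (2 * Δ))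
    have h3 : c / (2 * Δ) ≤ |c| / (2 * Δ) :=
      div_le_div_of_nonneg_right (le_abs_self c) (by positivity)
    have h4 : -c / (2 * Δ) ≤ |c| / (2 * Δ) :=
      div_le_div_of_nonneg_right (neg_le_abs c) (by positivity)
    rw [neg_div] at h4
    rw [e1, abs_le]
    constructor <;> linarith
  have hround' : ∀ c : ℝ, ⌊(c + Δ) / (2 * Δ)⌋ ≠ 0 → 1 ≤ |c| / s * v := by
    intro c hc
    have h1 : (1 : ℝ) ≤ |((⌊(c + Δ) / (2 * Δ)⌋ : ℤ) : ℝ)| := by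
      rw [← Int.cast_abs]
      exact_mod_cast Int.one_le_abs hc
    linarith [hround c]
  rcases le_total v 1 with hv1 | hv1
  · have h6 : v ^ 6 ≤ 1 := pow_le_one₀ hvpos.le hv1
    have hmin : min v (v ^ 6) = v ^ 6 :=
      min_eq_right (pow_le_of_le_one hvpos.le hv1 (by norm_num))
    obtain ⟨w, w0, wk, wz, wn⟩ := exists_code_length (ε := v ^ 6 / 2) (by positivity) (by linarith)
    refine ⟨w, w0, wk, fun c => ?_⟩
    rw [hmin]
    have hy : 0 ≤ |c| / s := by positivity
    have hexp := Real.one_le_exp hy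
    have hv6 : 0 < v ^ 6 := by positivity
    by_cases hk : ⌊(c + Δ) / (2 * Δ)⌋ = 0
    · rw [hk]
      nlinarith
    · have h1 := wn _ hk
      have h2 := hround c
      have h3 := hround' c hk
      set y := |c| / s
      rw [Real.log_div hv6.ne' (by norm_num), Real.log_pow] at h1
      have h4 : -Real.log v ≤ y := by
        rw [← Real.log_inv]
        have := Real.log_le_sub_one_of_pos (inv_pos.2 hvpos)
        have h5 : v⁻¹ ≤ y := by
          rw [inv_le_iff_one_le_mul₀ hvpos]; exact h3
        linarith
      have h5 : Real.log 2 ≤ 1 := by linarith [Real.log_two_lt_d9]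
      have h7 : y * v ≤ y := by nlinarith
      have h8 : w ⌊(c + Δ) / (2 * Δ)⌋ ≤ 9 * y := by
        push_cast at h1
        linarith
      have h9 : 1 ≤ (y * v) ^ 6 := one_le_pow₀ h3
      have h10 := Real.pow_div_factorial_le_exp y hy 7
      have h11 : y ^ 7 ≤ 5040 * Real.exp y := by
        rw [div_le_iff₀ (by positivity)] at h10
        norm_num [Nat.factorial] at h10
        linarith
      -- A nonzero rounding forces `y * v ≥ 1`, so six such factors can be inserted for free; then
      -- `y ^ 7 ≤ 7! * exp y`, and `9 * 5040 ≤ 50000`.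
      calc _ ≤ 9 * y := h8
        _ ≤ 9 * y * (y * v) ^ 6 := le_mul_of_one_le_right (by positivity) h9
        _ = 9 * v ^ 6 * y ^ 7 := by ring
        _ ≤ 9 * v ^ 6 * (5040 * Real.exp y) := by gcongr
        _ ≤ _ := by nlinarith [mul_pos hv6 (Real.exp_pos y)]
  · have hmin : min v (v ^ 6) = v := min_eq_left (le_self_pow₀ hv1 (by norm_num))
    obtain ⟨w, w0, wk, wz, wn⟩ := exists_code_length (ε := 1 / 2) (by norm_num) le_rfl
    refine ⟨w, w0, wk, fun c => ?_⟩
    rw [hmin]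
    have hy : 0 ≤ |c| / s := by positivity
    have h2 := hround c
    set y := |c| / s
    have hexp := Real.add_one_le_exp y
    have h1 : w ⌊(c + Δ) / (2 * Δ)⌋ ≤ 1 + 2 * |((⌊(c + Δ) / (2 * Δ)⌋ : ℤ) : ℝ)| := by
      by_cases hk : ⌊(c + Δ) / (2 * Δ)⌋ = 0
      · rw [hk]
        norm_num
        linarith
      · have := wn _ hk
        rw [one_div, Real.log_inv] at this
        linarith [Real.log_two_lt_d9]
    nlinarith [mul_pos hvpos (Real.exp_pos y)]

theorem abs_sub_le_of_floor_eq {Δ a b : ℝ} (hΔ : 0 < Δ)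
    (h : ⌊(a + Δ) / (2 * Δ)⌋ = ⌊(b + Δ) / (2 * Δ)⌋) : |a - b| ≤ 2 * Δ := by
  have h1 := Int.abs_sub_lt_one_of_floor_eq_floor h
  rw [← sub_div, abs_div, abs_of_pos (by positivity : 0 < 2 * Δ), div_lt_one (by positivity)] at h1
  simpa using h1.le

/-- Compares the fibre of `exists_large_fiber`, with `V = m / 10`, to the Hamming ball of
`card_near_le`. The base of the `m`-th power is at most 7/8, so 16 points are enough to beat the
factor 2. -/
theorem partial_coloring_numeric {m : ℕ} (hm : 16 ≤ m) :
    2 * Real.exp (2 * (m / 10)) * ((1 + Real.exp (-2)) / 2 * Real.exp (1 / 5)) ^ m < 1 := by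
  have h1 : Real.exp (2 * (m / 10)) = Real.exp (1 / 5) ^ m := by
    rw [← Real.exp_nat_mul]; congr 1; ring
  rw [h1, mul_assoc, ← mul_pow]
  have h2 : Real.exp (1 / 5) ^ 2 ≤ 3 / 2 := by
    refine le_of_pow_le_pow_left₀ (n := 5) (by norm_num) (by norm_num) ?_
    have h3 : (Real.exp (1 / 5) ^ 2) ^ 5 = Real.exp 1 ^ 2 := by
      rw [← pow_mul, ← Real.exp_nat_mul, ← Real.exp_nat_mul]
      norm_num
    rw [h3]
    nlinarith [Real.exp_one_lt_d9, Real.exp_pos 1]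
  have h3 : Real.exp (-2) ≤ 3 / 20 := by
    rw [← Real.le_log_iff_exp_le (by norm_num), show (3 / 20 : ℝ) = (20 / 3)⁻¹ by norm_num,
      Real.log_inv, neg_le_neg_iff]
    have := Real.log_le_sub_one_of_pos (show (0 : ℝ) < 20 / 3 / 8 by norm_num)
    rw [Real.log_div (by norm_num) (by norm_num), show (8 : ℝ) = 2 ^ (3 : ℕ) by norm_num,
      Real.log_pow] at this
    push_cast at this
    linarith [Real.log_two_lt_d9]
  have h4 : Real.exp (1 / 5) * ((1 + Real.exp (-2)) / 2 * Real.exp (1 / 5)) ≤ 7 / 8 := by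
    nlinarith [sq_nonneg (Real.exp (1 / 5))]
  calc 2 * (Real.exp (1 / 5) * ((1 + Real.exp (-2)) / 2 * Real.exp (1 / 5))) ^ m
      ≤ 2 * (7 / 8) ^ m := by gcongr
    _ ≤ 2 * (7 / 8) ^ 16 := by
        have := pow_le_pow_of_le_one (show (0 : ℝ) ≤ 7 / 8 by norm_num) (by norm_num) hm
        linarith
    _ < 1 := by norm_num

open Finset in
/-- Partial colouring: if the total cost of the prescribed discrepancies `Δ j` is at most
`#X / 10`, then some colouring of at least a tenth of `X` meets all of them. -/
theorem exists_partial_coloring {α ι : Type*} [Fintype α] [DecidableEq α] (X : Finset α)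
    (hX : 16 ≤ #X) (J : Finset ι) (B : ι → Finset α) (Δ : ι → ℝ) (hBX : ∀ j ∈ J, B j ⊆ X)
    (hB : ∀ j ∈ J, (B j).Nonempty) (hΔ : ∀ j ∈ J, 0 < Δ j)
    (hcost : ∑ j ∈ J, 200000 * min (√(#(B j)) / Δ j) ((√(#(B j)) / Δ j) ^ 6) ≤ (#X : ℝ) / 10) :
    ∃ ψ : α → ℤ, (∀ x, ψ x = 0 ∨ ψ x = 1 ∨ ψ x = -1) ∧ (∀ x, x ∉ X → ψ x = 0) ∧
      #X ≤ 10 * #{x ∈ X | ψ x ≠ 0} ∧ ∀ j ∈ J, |((∑ x ∈ B j, ψ x : ℤ) : ℝ)| ≤ Δ j := by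
  classical
  have hsq : ∀ j ∈ J, 0 < √(#(B j) : ℝ) := fun j hj =>
    Real.sqrt_pos.2 (by exact_mod_cast (hB j hj).card_pos)
  have hw : ∀ j : J, ∃ w : ℤ → ℝ, (∀ k, 0 ≤ w k) ∧
      (∀ T : Finset ℤ, ∑ k ∈ T, Real.exp (-w k) ≤ 1) ∧
      ∀ c : ℝ, w ⌊(c + Δ j) / (2 * Δ j)⌋ ≤
        50000 * min (√(#(B j)) / Δ j) ((√(#(B j)) / Δ j) ^ 6) *
          Real.exp (|c| / √(#(B j))) :=
    fun j => exists_rounding_weight (hΔ j j.2) (hsq j j.2)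
  choose w w0 wk wc using hw
  have hV : (0 : ℝ) < (#X : ℝ) / 10 := by
    have : (0 : ℝ) < #X := by exact_mod_cast (by omega : 0 < #X)
    positivity
  have hΩ : (Fintype.card (α → ℤˣ) : ℝ) = 2 ^ Fintype.card α := by
    rw [Fintype.card_fun, show Fintype.card ℤˣ = 2 from rfl]; push_cast; rfl
  obtain ⟨χ₀, hχ₀⟩ := exists_large_fiber
    (fun (j : J) (χ : α → ℤˣ) => ⌊((colorSum χ (B j) : ℝ) + Δ j) / (2 * Δ j)⌋) w w0 wk hV (by
      -- Here `200000 = 4 * 50000`, the 4 coming from `sum_exp_abs_colorSum_le`.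
      calc _ ≤ ∑ j : J, 200000 * min (√(#(B j)) / Δ j) ((√(#(B j)) / Δ j) ^ 6) *
              2 ^ Fintype.card α := by
            refine sum_le_sum fun j _ => ?_
            refine (sum_le_sum fun χ _ => wc j _).trans ?_
            rw [← mul_sum]
            have h1 := sum_exp_abs_colorSum_le (hB j j.2)
            have h2 : 0 ≤ min (√(#(B j) : ℝ) / Δ j) ((√(#(B j)) / Δ j) ^ 6) := by
              have := div_pos (hsq j j.2) (hΔ j j.2)
              positivity
            nlinarith
        _ = (∑ j ∈ J, 200000 * min (√(#(B j)) / Δ j) ((√(#(B j)) / Δ j) ^ 6)) *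
              2 ^ Fintype.card α := by
            rw [← sum_mul, sum_coe_sort J
              (fun j => 200000 * min (√(#(B j) : ℝ) / Δ j) ((√(#(B j)) / Δ j) ^ 6))]
        _ ≤ _ := by
            rw [hΩ]
            exact mul_le_mul_of_nonneg_right hcost (by positivity))
  have hnear := card_near_le X χ₀
  obtain ⟨χ, hχ, hfar⟩ : ∃ χ ∈ ({χ | ∀ j : J, ⌊((colorSum χ (B j) : ℝ) + Δ j) / (2 * Δ j)⌋ =
      ⌊((colorSum χ₀ (B j) : ℝ) + Δ j) / (2 * Δ j)⌋} : Finset (α → ℤˣ)),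
      χ ∉ ({χ | 10 * #{x ∈ X | χ₀ x ≠ χ x} < #X} : Finset (α → ℤˣ)) := by
    by_contra! hcon
    have h1 : (_ : ℝ) ≤ _ := Nat.cast_le.2 (card_le_card hcon)
    have h2 := h1.trans hnear
    rw [hΩ] at hχ₀
    have h3 := partial_coloring_numeric hX
    have h4 : (0 : ℝ) < 2 ^ Fintype.card α := by positivity
    have h5 := hχ₀.trans (mul_le_mul_of_nonneg_left h2 (by positivity))
    nlinarith
  simp only [mem_filter, mem_univ, true_and, not_lt] at hχ hfar
  have hne : ∀ u : ℤˣ, (u : ℤ) ≠ 0 := fun u => u.ne_zero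
  -- This is `(χ₀ - χ) / 2` on `X`; the halving turns the rounding error `2 * Δ j` into `Δ j`.
  refine ⟨fun x => if x ∈ X ∧ χ₀ x ≠ χ x then (χ₀ x : ℤ) else 0, fun x => ?_, fun x hx => ?_,
    ?_, fun j hj => ?_⟩
  · dsimp only
    split_ifs
    · rcases Int.units_eq_one_or (χ₀ x) with h | h <;> simp [h]
    · exact Or.inl rfl
  · simp [hx]
  · refine hfar.trans (Nat.mul_le_mul_left _ (card_le_card fun x hx => ?_))
    rw [mem_filter] at hx ⊢
    refine ⟨hx.1, ?_⟩
    simp only [if_pos hx]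
    exact hne _
  · have h1 := abs_sub_le_of_floor_eq (hΔ j hj) (hχ ⟨j, hj⟩).symm
    have h2 : colorSum χ₀ (B j) - colorSum χ (B j) =
        2 * ∑ x ∈ B j, (if x ∈ X ∧ χ₀ x ≠ χ x then (χ₀ x : ℤ) else 0) := by
      rw [colorSum, colorSum, ← sum_sub_distrib, mul_sum]
      refine sum_congr rfl fun x hx => ?_
      have hxX := hBX j hj hx
      rcases Int.units_eq_one_or (χ₀ x) with h | h <;>
        rcases Int.units_eq_one_or (χ x) with h' | h' <;> simp [h, h', hxX]
    rw [← Int.cast_sub, h2] at h1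
    push_cast at h1 ⊢
    rw [abs_mul, abs_two] at h1
    linarith

/-! ### Totient sums and the number of elements of large order. -/

-- The product over all of `2, ..., M + 1` telescopes to a value above 1/2, and leaving out factors
-- only increases it.
open Finset in
theorem half_le_prod_one_sub_inv_sq (S : Finset ℕ) (hS : ∀ k ∈ S, 2 ≤ k) :
    (1 / 2 : ℝ) ≤ ∏ k ∈ S, (1 - ((k : ℝ) ^ 2)⁻¹) := by
  have hIcc : ∀ M : ℕ, ∏ k ∈ Ico 2 (M + 2), (1 - ((k : ℝ) ^ 2)⁻¹) =
      (M + 2 : ℝ) / (2 * (M + 1)) := by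
    intro M
    induction M with
    | zero => simp
    | succ M ih =>
      rw [prod_Ico_succ_top (by omega), ih]
      push_cast
      field_simp
      ring
  have hfac : ∀ k : ℕ, 2 ≤ k → 0 ≤ 1 - ((k : ℝ) ^ 2)⁻¹ ∧ 1 - ((k : ℝ) ^ 2)⁻¹ ≤ 1 := by
    intro k hk
    have h2 : (1 : ℝ) ≤ (k : ℝ) ^ 2 := by
      exact_mod_cast Nat.one_le_pow _ _ (by omega)
    have := inv_le_one_of_one_le₀ h2
    have : 0 ≤ ((k : ℝ) ^ 2)⁻¹ := by positivity
    constructor <;> linarith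
  have hsub : S ⊆ Ico 2 (S.sup id + 2) := by
    intro k hk
    have : k ≤ S.sup id := le_sup (f := id) hk
    rw [mem_Ico]
    exact ⟨hS k hk, by omega⟩
  calc (1 / 2 : ℝ) ≤ ((S.sup id : ℕ) + 2 : ℝ) / (2 * ((S.sup id : ℕ) + 1)) := by
        rw [div_le_div_iff₀ (by norm_num) (by positivity)]
        linarith
    _ = _ := (hIcc _).symm
    _ = (∏ k ∈ Ico 2 (S.sup id + 2) \ S, (1 - ((k : ℝ) ^ 2)⁻¹)) *
          ∏ k ∈ S, (1 - ((k : ℝ) ^ 2)⁻¹) := (prod_sdiff hsub).symm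
    _ ≤ 1 * ∏ k ∈ S, (1 - ((k : ℝ) ^ 2)⁻¹) := by
        refine mul_le_mul_of_nonneg_right ?_ (prod_nonneg fun k hk => (hfac k (hS k hk)).1)
        refine prod_le_one (fun k hk => ?_) fun k hk => ?_ <;>
          have hk2 := (mem_Ico.1 (mem_sdiff.1 hk).1).1
        · exact (hfac k hk2).1
        · exact (hfac k hk2).2
    _ = _ := one_mul _

-- Expanding the product gives the reciprocals of the squarefree divisors.
open Finset in
theorem prod_one_add_inv_primeFactors_le {g : ℕ} (hg : g ≠ 0) :
    ∏ p ∈ g.primeFactors, (1 + (p : ℝ)⁻¹) ≤ ∑ e ∈ g.divisors, (e : ℝ)⁻¹ := by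
  have hprime : ∀ t ∈ g.primeFactors.powerset, ∀ p ∈ t, p.Prime := fun t ht p hp =>
    Nat.prime_of_mem_primeFactors (mem_powerset.1 ht hp)
  have hinj : Set.InjOn (fun t : Finset ℕ => ∏ p ∈ t, p) g.primeFactors.powerset := by
    intro t ht u hu htu
    rw [← Nat.primeFactors_prod (hprime t ht), ← Nat.primeFactors_prod (hprime u hu)]
    exact congrArg _ htu
  calc _ = ∑ t ∈ g.primeFactors.powerset, (((∏ p ∈ t, p : ℕ) : ℝ))⁻¹ := by
        rw [prod_one_add]
        refine sum_congr rfl fun t _ => ?_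
        rw [Nat.cast_prod, prod_inv_distrib]
    _ = ∑ e ∈ g.primeFactors.powerset.image (fun t => ∏ p ∈ t, p), (e : ℝ)⁻¹ :=
        (sum_image (f := fun e : ℕ => (e : ℝ)⁻¹) hinj).symm
    _ ≤ _ := by
        refine sum_le_sum_of_subset_of_nonneg ?_ fun e _ _ => by positivity
        intro e he
        obtain ⟨t, ht, rfl⟩ := mem_image.1 he
        rw [Nat.mem_divisors]
        exact ⟨(prod_dvd_prod_of_subset _ _ _ (mem_powerset.1 ht)).trans
          (Nat.prod_primeFactors_dvd g), hg⟩

-- Since `(1 - 1/p)(1 + 1/p) = 1 - 1/p²`, the inverse of `∏ (1 - 1/p)` is at most `2 ∏ (1 + 1/p)`.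
open Finset in
theorem inv_totient_le {g : ℕ} (hg : g ≠ 0) :
    ((Nat.totient g : ℝ))⁻¹ ≤ 2 * ∑ e ∈ g.divisors, (e : ℝ)⁻¹ * (g : ℝ)⁻¹ := by
  have hφ : (Nat.totient g : ℝ) = g * ∏ p ∈ g.primeFactors, (1 - (p : ℝ)⁻¹) := by
    have := Nat.totient_eq_mul_prod_factors g
    have h := congrArg (Rat.cast : ℚ → ℝ) this
    push_cast at h
    exact h
  have hφ0 : (0 : ℝ) < Nat.totient g := by
    exact_mod_cast Nat.totient_pos.2 (Nat.pos_of_ne_zero hg)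
  have hg0 : (0 : ℝ) < g := by exact_mod_cast Nat.pos_of_ne_zero hg
  have h1 := half_le_prod_one_sub_inv_sq g.primeFactors
    fun p hp => (Nat.prime_of_mem_primeFactors hp).two_le
  have h2 : ∏ p ∈ g.primeFactors, (1 - ((p : ℝ) ^ 2)⁻¹) =
      (∏ p ∈ g.primeFactors, (1 - (p : ℝ)⁻¹)) * ∏ p ∈ g.primeFactors, (1 + (p : ℝ)⁻¹) := by
    rw [← prod_mul_distrib]
    exact prod_congr rfl fun p _ => by ring
  rw [← sum_mul, inv_le_iff_one_le_mul₀ hφ0, hφ]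
  have h3 : 0 ≤ ∏ p ∈ g.primeFactors, (1 - (p : ℝ)⁻¹) := by
    rw [hφ] at hφ0
    exact (pos_of_mul_pos_right hφ0 hg0.le).le
  have h4 := mul_le_mul_of_nonneg_left (prod_one_add_inv_primeFactors_le hg) h3
  have h5 : 2 * ((∑ e ∈ g.divisors, (e : ℝ)⁻¹) * (g : ℝ)⁻¹) *
      (g * ∏ p ∈ g.primeFactors, (1 - (p : ℝ)⁻¹)) =
      2 * ((∏ p ∈ g.primeFactors, (1 - (p : ℝ)⁻¹)) * ∑ e ∈ g.divisors, (e : ℝ)⁻¹) := by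
    field_simp
  rw [h5]
  linarith

-- Writing `g = e * h` with `e` the divisor from `inv_totient_le`, the double sum is at most `(∑
-- 1/e²)(∑ 1/h)`.
open Finset in
theorem sum_inv_totient_le (t : ℕ) :
    ∑ g ∈ Icc 1 t, ((Nat.totient g : ℝ))⁻¹ ≤ 4 * (1 + Real.log t) := by
  have hharm : ∑ h ∈ Icc 1 t, ((h : ℝ))⁻¹ ≤ 1 + Real.log t := by
    have := harmonic_le_one_add_log t
    rw [harmonic_eq_sum_Icc] at this
    push_cast at this
    exact this
  have hsq : ∑ e ∈ Icc 1 t, ((e : ℝ))⁻¹ * (e : ℝ)⁻¹ ≤ 2 := by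
    have h : ∀ M : ℕ, ∑ e ∈ Icc 1 (M + 1), ((e : ℝ))⁻¹ * (e : ℝ)⁻¹ ≤ 2 - ((M : ℝ) + 1)⁻¹ := by
      intro M
      induction M with
      | zero => norm_num
      | succ M ih =>
        rw [sum_Icc_succ_top (by omega)]
        have h1 : ((M + 1 + 1 : ℕ) : ℝ)⁻¹ * ((M + 1 + 1 : ℕ) : ℝ)⁻¹ ≤
            ((M : ℝ) + 1)⁻¹ - (((M + 1 : ℕ) : ℝ) + 1)⁻¹ := by
          push_cast
          rw [inv_sub_inv (by positivity) (by positivity), ← mul_inv, inv_eq_one_div,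
            div_le_div_iff₀ (by positivity) (by positivity)]
          nlinarith [(Nat.cast_nonneg M : (0 : ℝ) ≤ M)]
        linarith
    rcases t with _ | M
    · simp
    · have := h M
      have h2 : 0 ≤ ((M : ℝ) + 1)⁻¹ := by positivity
      linarith
  have hmult : ∀ e ∈ Icc 1 t, ∑ g ∈ Icc 1 t with e ∣ g, ((g : ℝ))⁻¹ ≤
      (e : ℝ)⁻¹ * ∑ h ∈ Icc 1 t, ((h : ℝ))⁻¹ := by
    intro e he
    have he1 := (mem_Icc.1 he).1
    calc _ ≤ ∑ g ∈ (Icc 1 t).image (fun h => e * h), ((g : ℝ))⁻¹ := by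
          refine sum_le_sum_of_subset_of_nonneg ?_ fun e _ _ => by positivity
          intro g hg
          obtain ⟨hg1, h, rfl⟩ := mem_filter.1 hg
          rw [mem_Icc] at hg1
          refine mem_image_of_mem _ (mem_Icc.2 ⟨?_, ?_⟩)
          · rcases Nat.eq_zero_or_pos h with rfl | hh
            · simp at hg1
            · exact hh
          · exact (Nat.le_mul_of_pos_left h he1).trans hg1.2
      _ = _ := by
          rw [sum_image fun a _ b _ hab => Nat.eq_of_mul_eq_mul_left he1 hab, mul_sum]
          exact sum_congr rfl fun h _ => by rw [Nat.cast_mul, mul_inv]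
  have hlog : 0 ≤ ∑ h ∈ Icc 1 t, ((h : ℝ))⁻¹ := sum_nonneg fun h _ => by positivity
  calc ∑ g ∈ Icc 1 t, ((Nat.totient g : ℝ))⁻¹
      ≤ ∑ g ∈ Icc 1 t, 2 * ∑ e ∈ g.divisors, (e : ℝ)⁻¹ * (g : ℝ)⁻¹ :=
        sum_le_sum fun g hg => inv_totient_le (by rw [mem_Icc] at hg; omega)
    _ = 2 * ∑ g ∈ Icc 1 t, ∑ e ∈ Icc 1 t, if e ∣ g then (e : ℝ)⁻¹ * (g : ℝ)⁻¹ else 0 := by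
        rw [← mul_sum]
        congr 1
        refine sum_congr rfl fun g hg => ?_
        rw [← sum_filter]
        refine sum_congr ?_ fun _ _ => rfl
        rw [mem_Icc] at hg
        ext e
        simp only [Nat.mem_divisors, mem_filter, mem_Icc]
        constructor
        · rintro ⟨h1, h2⟩
          exact ⟨⟨Nat.pos_of_dvd_of_pos h1 hg.1, (Nat.le_of_dvd hg.1 h1).trans hg.2⟩, h1⟩
        · rintro ⟨_, h1⟩
          exact ⟨h1, by omega⟩
    _ = 2 * ∑ e ∈ Icc 1 t, (e : ℝ)⁻¹ * ∑ g ∈ Icc 1 t with e ∣ g, (g : ℝ)⁻¹ := by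
        rw [sum_comm]
        congr 1
        refine sum_congr rfl fun e _ => ?_
        rw [← sum_filter, mul_sum]
    _ ≤ 2 * ∑ e ∈ Icc 1 t, (e : ℝ)⁻¹ * ((e : ℝ)⁻¹ * ∑ h ∈ Icc 1 t, ((h : ℝ))⁻¹) := by
        refine mul_le_mul_of_nonneg_left (sum_le_sum fun e he => ?_) (by norm_num)
        exact mul_le_mul_of_nonneg_left (hmult e he) (by positivity)
    _ = 2 * ((∑ e ∈ Icc 1 t, (e : ℝ)⁻¹ * (e : ℝ)⁻¹) * ∑ h ∈ Icc 1 t, ((h : ℝ))⁻¹) := by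
        rw [sum_mul]
        congr 1
        exact sum_congr rfl fun e _ => by ring
    _ ≤ 2 * (2 * (1 + Real.log t)) := by
        refine mul_le_mul_of_nonneg_left ?_ (by norm_num)
        exact mul_le_mul hsq hharm hlog (by norm_num)
    _ = _ := by ring

open Finset in
/-- The number of elements of `ℤ/nℤ` of order at least `s`. -/
theorem card_addOrderOf_ge_le (n : ℕ) [NeZero n] {s : ℕ} (hs : 1 ≤ s) (hsn : s ≤ n) :
    (#{d : ZMod n | s ≤ addOrderOf d} : ℝ) ≤
      4 * Nat.totient n * (1 + Real.log ((n : ℝ) / s)) := by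
  have hn : n ≠ 0 := NeZero.ne n
  have h1 : #{d : ZMod n | s ≤ addOrderOf d} =
      ∑ N ∈ n.divisors, if s ≤ N then Nat.totient N else 0 := by
    rw [← sum_filter, card_eq_sum_card_fiberwise (f := addOrderOf)
      (t := n.divisors.filter (s ≤ ·))]
    · refine sum_congr rfl fun N hN => ?_
      rw [mem_filter, Nat.mem_divisors] at hN
      rw [← IsAddCyclic.card_addOrderOf_eq_totient (α := ZMod n) (d := N)
        (by rw [ZMod.card]; exact hN.1.1)]
      congr 1
      ext d
      simp only [mem_filter, mem_univ, true_and]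
      constructor
      · exact fun h => h.2
      · exact fun h => ⟨h ▸ hN.2, h⟩
    · intro d hd
      have hd' : s ≤ addOrderOf d := by simpa using hd
      have := addOrderOf_dvd_card (x := d)
      rw [ZMod.card] at this
      simp [this, hd', hn]
  have hφ : (0 : ℝ) ≤ Nat.totient n := Nat.cast_nonneg _
  calc (#{d : ZMod n | s ≤ addOrderOf d} : ℝ)
      = ∑ g ∈ n.divisors, if s ≤ n / g then (Nat.totient (n / g) : ℝ) else 0 := by
        rw [h1, ← Nat.sum_div_divisors n]
        push_cast
        rfl
    _ = ∑ g ∈ n.divisors with s ≤ n / g, (Nat.totient (n / g) : ℝ) := (sum_filter _ _).symm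
    -- The orders are `n / g`, and `φ(g) * φ(n / g) ≤ φ(n)`.
    _ ≤ ∑ g ∈ n.divisors with s ≤ n / g, Nat.totient n * (Nat.totient g : ℝ)⁻¹ := by
        refine sum_le_sum fun g hg => ?_
        have hgn := (Nat.mem_divisors.1 (mem_filter.1 hg).1).1
        have hg0 : 0 < g := Nat.pos_of_dvd_of_pos hgn (Nat.pos_of_ne_zero hn)
        have hφg : (0 : ℝ) < Nat.totient g := by exact_mod_cast Nat.totient_pos.2 hg0
        have h2 := Nat.totient_super_multiplicative g (n / g)
        rw [Nat.mul_div_cancel' hgn] at h2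
        rw [← div_eq_mul_inv, le_div_iff₀ hφg, mul_comm]
        exact_mod_cast h2
    _ ≤ ∑ g ∈ Icc 1 (n / s), Nat.totient n * (Nat.totient g : ℝ)⁻¹ := by
        refine sum_le_sum_of_subset_of_nonneg ?_ fun e _ _ => by positivity
        intro g hg
        rw [mem_filter, Nat.mem_divisors] at hg
        have hg0 : 0 < g := Nat.pos_of_dvd_of_pos hg.1.1 (Nat.pos_of_ne_zero hn)
        rw [mem_Icc]
        refine ⟨hg0, ?_⟩
        rw [Nat.le_div_iff_mul_le hg0] at hg
        rw [Nat.le_div_iff_mul_le hs, mul_comm]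
        exact hg.2
    _ ≤ Nat.totient n * (4 * (1 + Real.log ((n / s : ℕ) : ℝ))) := by
        rw [← mul_sum]
        exact mul_le_mul_of_nonneg_left (sum_inv_totient_le _) hφ
    _ ≤ Nat.totient n * (4 * (1 + Real.log ((n : ℝ) / s))) := by
        have h3 : 0 < n / s := Nat.div_pos hsn hs
        have h4 := Real.log_le_log (by exact_mod_cast h3) (Nat.cast_div_le (m := n) (n := s) (α := ℝ))
        gcongr
    _ = _ := by ring

/-! ### Reduction of progressions to aligned blocks in cosets. -/

open Finset in
/-- Prefix sums are controlled by sums over aligned blocks of lengths `16 ^ i`. -/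
theorem abs_sum_range_le_of_blocks (f : ℕ → ℤ) (D : ℕ → ℝ) (R I : ℕ) (hR : R < 16 ^ (I + 1))
    (h : ∀ i t, i ≤ I → 16 ^ i * (t + 1) ≤ R →
      |((∑ r ∈ Ico (16 ^ i * t) (16 ^ i * (t + 1)), f r : ℤ) : ℝ)| ≤ D i) (hD : ∀ i, 0 ≤ D i) :
    |((∑ r ∈ range R, f r : ℤ) : ℝ)| ≤ 15 * ∑ i ∈ range (I + 1), D i := by
  set S : ℕ → ℤ := fun k => ∑ r ∈ range k, f r with hS
  have hrun : ∀ i ≤ I, ∀ a k, 16 ^ i * (a + k) ≤ R →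
      |((S (16 ^ i * (a + k)) - S (16 ^ i * a) : ℤ) : ℝ)| ≤ k * D i := by
    intro i hi a k
    induction k with
    | zero => intro _; simp
    | succ k ih =>
      intro hk
      have h1 := ih ((Nat.mul_le_mul_left _ (by omega)).trans hk)
      have h2 := h i (a + k) hi hk
      have h3 : S (16 ^ i * (a + (k + 1))) - S (16 ^ i * a) =
          (S (16 ^ i * (a + k)) - S (16 ^ i * a)) +
            ∑ r ∈ Ico (16 ^ i * (a + k)) (16 ^ i * (a + k + 1)), f r := by
        rw [sum_Ico_eq_sub _ (Nat.mul_le_mul_left _ (by omega))]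
        simp only [hS, add_assoc]
        ring
      rw [h3, Int.cast_add]
      refine (abs_add_le _ _).trans ?_
      push_cast at h1 h2 ⊢
      linarith
  -- Base-16 digits of `R` are stripped from the lowest; the digit `T % 16 ≤ 15` counts the blocks
  -- removed at level `j`.
  have hmain : ∀ j ≤ I + 1, |((S R - S (16 ^ j * (R / 16 ^ j)) : ℤ) : ℝ)| ≤
      15 * ∑ i ∈ range j, D i := by
    intro j
    induction j with
    | zero => intro _; simp
    | succ j ih =>
      intro hj
      have h1 := ih (by omega)
      set T := R / 16 ^ j with hT
      have e1 : 16 ^ (j + 1) * (R / 16 ^ (j + 1)) = 16 ^ j * (16 * (T / 16)) := by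
        rw [pow_succ, ← Nat.div_div_eq_div_mul, mul_assoc]
      have e2 : 16 * (T / 16) + T % 16 = T := Nat.div_add_mod T 16
      have h2 := hrun j (by omega) (16 * (T / 16)) (T % 16) (by
        rw [e2]; exact Nat.mul_div_le R _)
      rw [e2] at h2
      have h3 : ((T % 16 : ℕ) : ℝ) ≤ 15 := by
        exact_mod_cast (by omega : T % 16 ≤ 15)
      have h4 := mul_le_mul_of_nonneg_right h3 (hD j)
      rw [e1, sum_range_succ]
      have e3 : S R - S (16 ^ j * (16 * (T / 16))) = (S R - S (16 ^ j * T)) +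
          (S (16 ^ j * T) - S (16 ^ j * (16 * (T / 16)))) := by ring
      rw [e3, Int.cast_add]
      refine (abs_add_le _ _).trans ?_
      linarith
  have := hmain (I + 1) le_rfl
  rw [Nat.div_eq_of_lt hR, mul_zero] at this
  simpa [hS] using this

theorem injOn_add_mul {n : ℕ} [NeZero n] (a d : ZMod n) :
    Set.InjOn (fun k : ℕ => a + (k : ZMod n) * d) (Set.Iio (addOrderOf d)) := by
  intro i hi j hj hij
  have h : i • d = j • d := by simpa [nsmul_eq_mul] using hij
  have h' : i % addOrderOf d = j % addOrderOf d := nsmul_inj_mod.1 h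
  rwa [Nat.mod_eq_of_lt hi, Nat.mod_eq_of_lt hj] at h'

open Finset in
theorem sum_modAP {n : ℕ} [NeZero n] (ψ : ZMod n → ℤ) (a d : ZMod n) {l : ℕ}
    (hl : l ≤ addOrderOf d) :
    ∑ x ∈ modAP a d l, ψ x = ∑ k ∈ range l, ψ (a + k * d) := by
  rw [modAP, sum_image]
  refine (injOn_add_mul a d).mono fun k hk => ?_
  rw [coe_range] at hk
  exact lt_of_lt_of_le hk hl

theorem modAP_eq_of_addOrderOf_le {n : ℕ} [NeZero n] (a d : ZMod n) {l : ℕ}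
    (hl : addOrderOf d ≤ l) : modAP a d l = modAP a d (addOrderOf d) := by
  ext x
  simp only [modAP, Finset.mem_image, Finset.mem_range]
  constructor
  · rintro ⟨k, _, rfl⟩
    refine ⟨k % addOrderOf d, Nat.mod_lt _ (addOrderOf_pos d), ?_⟩
    rw [← nsmul_eq_mul, ← nsmul_eq_mul, mod_addOrderOf_nsmul]
  · rintro ⟨k, hk, rfl⟩
    exact ⟨k, by omega, rfl⟩

open Finset in
/-- Progressions inside a coset are controlled by the progressions starting at a fixed point. -/
theorem abs_sum_modAP_le {n : ℕ} [NeZero n] (ψ : ZMod n → ℤ) (a d : ZMod n) {M : ℝ}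
    (hM : ∀ k ≤ addOrderOf d, |((∑ j ∈ range k, ψ (a + (j : ZMod n) * d) : ℤ) : ℝ)| ≤ M)
    {α : ℕ} (hα : α < addOrderOf d) (l : ℕ) :
    |((∑ x ∈ modAP (a + (α : ZMod n) * d) d l, ψ x : ℤ) : ℝ)| ≤ 3 * M := by
  wlog hl : l ≤ addOrderOf d generalizing l
  · rw [modAP_eq_of_addOrderOf_le _ _ (not_le.1 hl).le]
    exact this _ le_rfl
  set N := addOrderOf d
  set H : ℕ → ℤ := fun k => ∑ j ∈ range k, ψ (a + (j : ZMod n) * d) with hH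
  have hM0 : 0 ≤ M := (abs_nonneg _).trans (hM 0 (Nat.zero_le _))
  have hper : ∀ k, H (N + k) = H N + H k := by
    intro k
    simp only [hH]
    rw [sum_range_add]
    congr 1
    refine sum_congr rfl fun j _ => ?_
    have : ((N : ℕ) : ZMod n) * d = 0 := by
      rw [← nsmul_eq_mul]; exact addOrderOf_nsmul_eq_zero d
    push_cast
    rw [add_mul, this, zero_add]
  have hsum : ∑ x ∈ modAP (a + (α : ZMod n) * d) d l, ψ x = H (α + l) - H α := by
    rw [sum_modAP _ _ _ hl]
    simp only [hH]
    rw [sum_range_add, add_sub_cancel_left]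
    refine sum_congr rfl fun j _ => ?_
    push_cast
    rw [add_mul, add_assoc]
  rw [hsum]
  have h1 := abs_le.1 (hM α hα.le)
  by_cases hle : α + l ≤ N
  · have h2 := abs_le.1 (hM _ hle)
    rw [Int.cast_sub, abs_le]
    constructor <;> simp only [hH] at * <;> linarith
  -- The progression wraps past the base point: its sum is `H N + H (k + 1) - H α`, hence the
  -- constant 3.
  · obtain ⟨k, hk⟩ := Nat.exists_eq_add_of_lt (not_le.1 hle)
    have hk' : α + l = N + (k + 1) := by omega
    have h2 := abs_le.1 (hM N le_rfl)
    have h3 := abs_le.1 (hM (k + 1) (by omega))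
    rw [hk', hper, Int.cast_sub, Int.cast_add, abs_le]
    constructor <;> simp only [hH] at * <;> linarith

-- Reindexes a progression by its points in `X` alone, so that the number of blocks scales with
-- `#X`.
open Finset in
theorem exists_enumeration (P : ℕ → Prop) [DecidablePred P] (N : ℕ) :
    ∃ ρ : ℕ → ℕ, (∀ r < Nat.count P N, P (ρ r) ∧ ρ r < N) ∧
      Set.InjOn ρ (Set.Iio (Nat.count P N)) ∧
      ∀ g : ℕ → ℤ, (∀ j, ¬ P j → g j = 0) → ∀ k,
        ∑ j ∈ range k, g j = ∑ r ∈ range (Nat.count P k), g (ρ r) := by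
  refine ⟨Nat.nth P, fun r hr => ⟨Nat.nth_mem r fun hf => hr.trans_le (Nat.count_le_card hf N),
    Nat.nth_lt_of_lt_count hr⟩, fun r hr s hs hrs => ?_, fun g hg k => ?_⟩
  · rw [← Nat.count_nth fun hf => lt_of_lt_of_le hr (Nat.count_le_card hf N),
      ← Nat.count_nth fun hf => lt_of_lt_of_le hs (Nat.count_le_card hf N), hrs]
  · induction k with
    | zero => simp
    | succ k ih =>
      rw [sum_range_succ, ih, Nat.count_succ]
      split_ifs with hk
      · rw [sum_range_succ, Nat.nth_count hk]
      · rw [hg k hk]; simp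

/-- A fixed representative of the coset of `x` modulo the subgroup generated by `d`. -/
noncomputable def cosetRep {n : ℕ} (d x : ZMod n) : ZMod n :=
  (QuotientAddGroup.mk x : ZMod n ⧸ AddSubgroup.zmultiples d).out

theorem cosetRep_add_mul {n : ℕ} (d x : ZMod n) (k : ℕ) :
    cosetRep d (x + k * d) = cosetRep d x := by
  unfold cosetRep
  congr 1
  rw [QuotientAddGroup.eq, ← nsmul_eq_mul]
  have : -(x + k • d) + x = (-(k : ℤ)) • d := by
    rw [neg_zsmul, natCast_zsmul]; abel
  rw [this]
  exact AddSubgroup.zsmul_mem_zmultiples _ _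

theorem cosetRep_cosetRep {n : ℕ} (d x : ZMod n) : cosetRep d (cosetRep d x) = cosetRep d x := by
  unfold cosetRep
  rw [QuotientAddGroup.out_eq']

theorem exists_eq_cosetRep_add {n : ℕ} [NeZero n] (d x : ZMod n) :
    ∃ α < addOrderOf d, x = cosetRep d x + α * d := by
  have h : (QuotientAddGroup.mk (cosetRep d x) : ZMod n ⧸ AddSubgroup.zmultiples d) =
      QuotientAddGroup.mk x := QuotientAddGroup.out_eq' _
  rw [QuotientAddGroup.eq, mem_zmultiples_iff_mem_range_addOrderOf, Finset.mem_image] at h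
  obtain ⟨α, hα, h⟩ := h
  refine ⟨α, Finset.mem_range.1 hα, ?_⟩
  rw [← nsmul_eq_mul, h]
  abel

open Finset in
theorem sum_count_cosetRep_le {n : ℕ} [NeZero n] (X : Finset (ZMod n)) (d : ZMod n) :
    ∑ a ∈ univ.image (cosetRep d),
      Nat.count (fun k : ℕ => a + (k : ZMod n) * d ∈ X) (addOrderOf d) ≤ #X := by
  rw [card_eq_sum_card_fiberwise (f := cosetRep d) (s := X) (t := univ.image (cosetRep d))
    (fun x _ => by simp)]
  refine sum_le_sum fun a ha => ?_
  obtain ⟨x, _, rfl⟩ := mem_image.1 ha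
  rw [Nat.count_eq_card_filter_range]
  refine card_le_card_of_injOn (fun k : ℕ => cosetRep d x + (k : ZMod n) * d) (fun k hk => ?_) ?_
  · rw [mem_coe, mem_filter] at hk ⊢
    exact ⟨hk.2, by rw [cosetRep_add_mul, cosetRep_cosetRep]⟩
  · refine (injOn_add_mul _ d).mono fun k hk => ?_
    rw [mem_coe, mem_filter, mem_range] at hk
    exact hk.1

open Finset in
theorem exists_partial_coloring_modAP {n : ℕ} [NeZero n] (X : Finset (ZMod n)) (hX : 16 ≤ #X)
    {I : ℕ} (hI : #X < 16 ^ (I + 1)) (Δ : ℕ → ℝ) (hΔ : ∀ i, 0 < Δ i)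
    (hcost : ∑ i ∈ range (I + 1), 200000 * min (4 ^ i / Δ i) ((4 ^ i / Δ i) ^ 6) *
      ((#{d : ZMod n | 16 ^ i ≤ addOrderOf d} : ℝ) / 16 ^ i) ≤ 1 / 10) :
    ∃ ψ : ZMod n → ℤ, (∀ x, ψ x = 0 ∨ ψ x = 1 ∨ ψ x = -1) ∧ (∀ x, x ∉ X → ψ x = 0) ∧
      #X ≤ 10 * #{x ∈ X | ψ x ≠ 0} ∧ ∀ a d l, |((∑ x ∈ modAP a d l, ψ x : ℤ) : ℝ)| ≤
        45 * ∑ i ∈ range (I + 1), Δ i := by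
  classical
  let ℓ : ZMod n → ZMod n → ℕ := fun d a =>
    Nat.count (fun k : ℕ => a + (k : ZMod n) * d ∈ X) (addOrderOf d)
  choose ρ hρP hρinj hρsum using fun d a : ZMod n =>
    exists_enumeration (fun k : ℕ => a + (k : ZMod n) * d ∈ X) (addOrderOf d)
  let e : ZMod n → ZMod n → ℕ → ZMod n := fun d a r => a + (ρ d a r : ZMod n) * d
  have hℓN : ∀ d a, ℓ d a ≤ addOrderOf d := fun d a => Nat.count_le _
  have heX : ∀ d a, ∀ r < ℓ d a, e d a r ∈ X := fun d a r hr => (hρP d a r hr).1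
  have heinj : ∀ d a, Set.InjOn (e d a) (Set.Iio (ℓ d a)) := by
    intro d a r hr s hs hrs
    exact hρinj d a hr hs (injOn_add_mul a d (hρP d a r hr).2 (hρP d a s hs).2 hrs)
  have hsumℓ : ∀ d, ∑ a ∈ univ.image (cosetRep d), ℓ d a ≤ #X := sum_count_cosetRep_le X
  have hℓX : ∀ d x, ℓ d (cosetRep d x) ≤ #X := fun d x =>
    (single_le_sum (f := ℓ d) (fun _ _ => Nat.zero_le _)
      (mem_image_of_mem _ (mem_univ x))).trans (hsumℓ d)
  -- The index `(d, a, i, t)` is the `t`-th complete block of `16 ^ i` consecutive points of `X` in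
  -- the coset of `a`.
  let J : Finset (Σ _ : ZMod n, Σ _ : ZMod n, Σ _ : ℕ, ℕ) :=
    univ.sigma fun d => (univ.image (cosetRep d)).sigma fun a =>
      (range (I + 1)).sigma fun i => range (ℓ d a / 16 ^ i)
  let B : (Σ _ : ZMod n, Σ _ : ZMod n, Σ _ : ℕ, ℕ) → Finset (ZMod n) := fun j =>
    (Ico (16 ^ j.2.2.1 * j.2.2.2) (16 ^ j.2.2.1 * (j.2.2.2 + 1))).image (e j.1 j.2.1)
  have hend : ∀ j ∈ J, 16 ^ j.2.2.1 * (j.2.2.2 + 1) ≤ ℓ j.1 j.2.1 := by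
    rintro ⟨d, a, i, t⟩ hj
    simp only [J, mem_sigma, mem_range] at hj
    exact (Nat.mul_le_mul_left _ hj.2.2.2).trans (Nat.mul_div_le _ _)
  have hinjB : ∀ j ∈ J, Set.InjOn (e j.1 j.2.1)
      (Ico (16 ^ j.2.2.1 * j.2.2.2) (16 ^ j.2.2.1 * (j.2.2.2 + 1))) := by
    intro j hj
    refine (heinj j.1 j.2.1).mono fun r hr => ?_
    rw [coe_Ico] at hr
    exact hr.2.trans_le (hend j hj)
  have hcard : ∀ j ∈ J, #(B j) = 16 ^ j.2.2.1 := by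
    intro j hj
    rw [card_image_of_injOn (hinjB j hj), Nat.card_Ico, ← Nat.mul_sub, Nat.add_sub_cancel_left,
      mul_one]
  have hsqrt : ∀ j ∈ J, √(#(B j) : ℝ) = 4 ^ j.2.2.1 := by
    intro j hj
    rw [hcard j hj, Nat.cast_pow, show ((16 : ℕ) : ℝ) = 4 ^ 2 by norm_num, ← pow_mul, mul_comm,
      pow_mul, Real.sqrt_sq (by positivity)]
  have hlevel : ∀ i, ((∑ d, ∑ a ∈ univ.image (cosetRep d), ℓ d a / 16 ^ i : ℕ) : ℝ) ≤
      #X * ((#{d : ZMod n | 16 ^ i ≤ addOrderOf d} : ℝ) / 16 ^ i) := by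
    intro i
    -- A coset of `⟨d⟩` with fewer than `16 ^ i` elements has no complete block at level `i`.
    have h1 : ∀ d, (∑ a ∈ univ.image (cosetRep d), ℓ d a / 16 ^ i) * 16 ^ i ≤
        if 16 ^ i ≤ addOrderOf d then #X else 0 := by
      intro d
      split_ifs with hd
      · rw [sum_mul]
        exact (sum_le_sum fun a _ => Nat.div_mul_le_self _ _).trans (hsumℓ d)
      · rw [sum_eq_zero fun a _ => Nat.div_eq_of_lt ((hℓN d a).trans_lt (not_le.1 hd)), zero_mul]
    have h2 : (∑ d, ∑ a ∈ univ.image (cosetRep d), ℓ d a / 16 ^ i) * 16 ^ i ≤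
        #X * #{d : ZMod n | 16 ^ i ≤ addOrderOf d} := by
      rw [sum_mul]
      refine (sum_le_sum fun d _ => h1 d).trans ?_
      rw [← sum_filter, sum_const, smul_eq_mul, mul_comm]
    rw [← mul_div_assoc, le_div_iff₀ (by positivity)]
    exact_mod_cast h2
  obtain ⟨ψ, hψ1, hψX, hψm, hψB⟩ := exists_partial_coloring X hX J B (fun j => Δ j.2.2.1)
    (by
      intro j hj x hx
      obtain ⟨r, hr, rfl⟩ := mem_image.1 hx
      exact heX _ _ r ((mem_Ico.1 hr).2.trans_le (hend j hj)))
    (by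
      intro j hj
      rw [← card_pos, hcard j hj]
      positivity)
    (fun j _ => hΔ _)
    (by
      set c : ℕ → ℝ := fun i => 200000 * min (4 ^ i / Δ i) ((4 ^ i / Δ i) ^ 6) with hc
      have hc0 : ∀ i, 0 ≤ c i := by
        intro i
        have := hΔ i
        simp only [hc]
        positivity
      calc _ = ∑ j ∈ J, c j.2.2.1 := by
            refine sum_congr rfl fun j hj => ?_
            rw [hsqrt j hj]
        _ = ∑ i ∈ range (I + 1),
              c i * ((∑ d, ∑ a ∈ univ.image (cosetRep d), ℓ d a / 16 ^ i : ℕ) : ℝ) := by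
            simp only [J, sum_sigma, sum_const, card_range, nsmul_eq_mul]
            push_cast
            simp only [mul_sum]
            conv_lhs =>
              enter [2, d]
              rw [sum_comm]
            rw [sum_comm]
            refine sum_congr rfl fun i _ => sum_congr rfl fun d _ => sum_congr rfl fun a _ => ?_
            ring
        _ ≤ ∑ i ∈ range (I + 1),
              c i * (#X * ((#{d : ZMod n | 16 ^ i ≤ addOrderOf d} : ℝ) / 16 ^ i)) :=
            sum_le_sum fun i _ => mul_le_mul_of_nonneg_left (hlevel i) (hc0 i)
        _ = #X * ∑ i ∈ range (I + 1),
              c i * ((#{d : ZMod n | 16 ^ i ≤ addOrderOf d} : ℝ) / 16 ^ i) := by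
            rw [mul_sum]
            exact sum_congr rfl fun i _ => by ring
        _ ≤ #X * (1 / 10) := mul_le_mul_of_nonneg_left hcost (Nat.cast_nonneg _)
        _ = _ := by ring)
  refine ⟨ψ, hψ1, hψX, hψm, fun b d l => ?_⟩
  obtain ⟨α, hα, hb⟩ := exists_eq_cosetRep_add d b
  rw [hb]
  have hpre : ∀ k ≤ addOrderOf d,
      |((∑ j ∈ range k, ψ (cosetRep d b + j * d) : ℤ) : ℝ)| ≤
        15 * ∑ i ∈ range (I + 1), Δ i := by
    intro k hk
    rw [hρsum d (cosetRep d b) (fun j => ψ (cosetRep d b + j * d)) (fun j hj => hψX _ hj) k]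
    have hkℓ : Nat.count (fun k : ℕ => cosetRep d b + (k : ZMod n) * d ∈ X) k ≤
        ℓ d (cosetRep d b) := Nat.count_monotone _ hk
    refine abs_sum_range_le_of_blocks _ Δ _ I ((hkℓ.trans (hℓX d b)).trans_lt hI) ?_
      fun i => (hΔ i).le
    intro i t hi ht
    have hj : (⟨d, cosetRep d b, i, t⟩ : Σ _ : ZMod n, Σ _ : ZMod n, Σ _ : ℕ, ℕ) ∈ J := by
      simp only [J, mem_sigma, mem_univ, mem_range, true_and]
      refine ⟨mem_image_of_mem _ (mem_univ b), by omega, ?_⟩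
      rw [← Nat.succ_le_iff, Nat.le_div_iff_mul_le (by positivity), mul_comm]
      exact ht.trans hkℓ
    have := hψB _ hj
    rw [sum_image (hinjB _ hj)] at this
    exact this
  -- The constant is `45 = 3 * 15`.
  have := abs_sum_modAP_le ψ (cosetRep d b) d hpre hα l
  linarith

/-! ### Scales and the choice of the prescribed discrepancies. -/

/-- The weight `2 ^ (-|i - q|)`. -/
noncomputable def scaleWeight (q i : ℕ) : ℝ := (1 / 2) ^ ((i - q) + (q - i))

theorem scaleWeight_pos (q i : ℕ) : 0 < scaleWeight q i := by
  unfold scaleWeight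
  positivity

theorem scaleWeight_succ_of_lt {q i : ℕ} (h : i < q) :
    scaleWeight q (i + 1) = 2 * scaleWeight q i := by
  unfold scaleWeight
  rw [show (i - q) + (q - i) = ((i + 1 - q) + (q - (i + 1))) + 1 by omega, pow_succ]
  ring

theorem scaleWeight_succ_of_le {q i : ℕ} (h : q ≤ i) :
    2 * scaleWeight q (i + 1) = scaleWeight q i := by
  unfold scaleWeight
  rw [show (i + 1 - q) + (q - (i + 1)) = ((i - q) + (q - i)) + 1 by omega, pow_succ]
  ring

theorem sum_scaleWeight_le_two_mul {q I : ℕ} (h : I ≤ q) :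
    ∑ i ∈ Finset.range (I + 1), scaleWeight q i ≤ 2 * scaleWeight q I := by
  induction I with
  | zero =>
    have := scaleWeight_pos q 0
    simp only [zero_add, Finset.sum_range_one]
    linarith
  | succ I ih =>
    rw [Finset.sum_range_succ]
    have := ih (by omega)
    rw [scaleWeight_succ_of_lt (by omega)] at *
    linarith

theorem sum_scaleWeight_le_three (q I : ℕ) :
    ∑ i ∈ Finset.range (I + 1), scaleWeight q i ≤ 3 := by
  have hself : scaleWeight q q = 1 := by simp [scaleWeight]
  have hle : ∀ i, scaleWeight q i ≤ 1 := fun i => pow_le_one₀ (by norm_num) (by norm_num)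
  rcases le_total I q with h | h
  · linarith [sum_scaleWeight_le_two_mul h, hle I]
  · have : ∑ i ∈ Finset.range (I + 1), scaleWeight q i ≤ 3 - scaleWeight q I := by
      induction I, h using Nat.le_induction with
      | base => linarith [sum_scaleWeight_le_two_mul (le_refl q)]
      | succ I hI ih =>
        rw [Finset.sum_range_succ]
        linarith [scaleWeight_succ_of_le hI]
    linarith [scaleWeight_pos q I]

/-- Inner sums up to `q` decay geometrically away from `q`; each scale beyond `q` adds at most 3.
These scales produce the extra factor `L` in the theorem. -/
theorem sum_sum_scaleWeight_le (q M : ℕ) :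
    ∑ I ∈ Finset.range (M + 1), ∑ i ∈ Finset.range (I + 1), scaleWeight q i ≤
      4 + 3 * ((M - q : ℕ) : ℝ) := by
  have hle : ∀ i, scaleWeight q i ≤ 1 := fun i => pow_le_one₀ (by norm_num) (by norm_num)
  have hsmall : ∀ M ≤ q,
      ∑ I ∈ Finset.range (M + 1), ∑ i ∈ Finset.range (I + 1), scaleWeight q i ≤ 4 := by
    intro M hM
    calc _ ≤ ∑ I ∈ Finset.range (M + 1), 2 * scaleWeight q I :=
          Finset.sum_le_sum fun I hI =>
            sum_scaleWeight_le_two_mul (by rw [Finset.mem_range] at hI; omega)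
      _ ≤ 4 := by
          rw [← Finset.mul_sum]
          linarith [sum_scaleWeight_le_two_mul hM, hle M]
  rcases le_total M q with h | h
  · rw [Nat.sub_eq_zero_of_le h]
    simpa using hsmall M h
  · induction M, h using Nat.le_induction with
    | base => simpa using hsmall q le_rfl
    | succ M hM ih =>
      rw [Finset.sum_range_succ, Nat.succ_sub hM]
      push_cast
      linarith [sum_scaleWeight_le_three q (M + 1)]

section Scale

variable {n : ℕ} [NeZero n]

theorem one_le_totient_real (n : ℕ) [NeZero n] : (1 : ℝ) ≤ Nat.totient n := by
  exact_mod_cast Nat.totient_pos.2 (NeZero.pos n)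

theorem log_div_totient_nonneg (n : ℕ) [NeZero n] :
    0 ≤ Real.log ((n : ℝ) / Nat.totient n) := by
  refine Real.log_nonneg ?_
  rw [le_div_iff₀ (by linarith [one_le_totient_real n]), one_mul]
  exact_mod_cast Nat.totient_le n

/-- Below `q`, `32 = 16 * 2`: the 16 is the ratio of block lengths, the 2 absorbs the linear growth
of the logarithm. Above `q` the logarithm is at most its value at `φ(n)`. -/
theorem card_addOrderOf_ge_div_le {q : ℕ}
    (hq : (Nat.totient n : ℝ) * (1 + Real.log ((n : ℝ) / Nat.totient n)) ≤ 16 ^ q) (i : ℕ) :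
    (((Finset.univ.filter fun d : ZMod n => 16 ^ i ≤ addOrderOf d).card : ℕ) : ℝ) / 16 ^ i ≤
      12 * 32 ^ (q - i) * (1 / 16) ^ (i - q) := by
  have hφ := one_le_totient_real n
  have hlog := log_div_totient_nonneg n
  set Φ : ℝ := (Nat.totient n : ℝ)
  set L : ℝ := 1 + Real.log ((n : ℝ) / Φ) with hL
  by_cases hin : 16 ^ i ≤ n
  · have hcount := card_addOrderOf_ge_le n (s := 16 ^ i) (Nat.one_le_pow _ _ (by norm_num)) hin
    have hn : (0 : ℝ) < n := by exact_mod_cast NeZero.pos n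
    have hΦq : Φ ≤ 16 ^ q := le_trans (by nlinarith) hq
    have hlog16 : Real.log 16 ≤ 3 := by
      rw [show (16 : ℝ) = 2 ^ (4 : ℕ) by norm_num, Real.log_pow]
      push_cast
      linarith [Real.log_two_lt_d9]
    have h1 : Real.log ((n : ℝ) / (16 ^ i : ℕ)) ≤ Real.log ((n : ℝ) / Φ) + 3 * (q - i : ℕ) := by
      have h2 : (n : ℝ) / (16 ^ i : ℕ) ≤ (n : ℝ) / Φ * 16 ^ (q - i) := by
        push_cast
        rw [div_mul_eq_mul_div, div_le_div_iff₀ (by positivity) (by linarith), mul_assoc,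
          ← pow_add]
        refine mul_le_mul_of_nonneg_left (hΦq.trans ?_) hn.le
        exact pow_le_pow_right₀ (by norm_num) (by omega)
      refine (Real.log_le_log (by positivity) h2).trans ?_
      rw [Real.log_mul (by positivity) (by positivity), Real.log_pow]
      nlinarith [(Nat.cast_nonneg (q - i) : (0 : ℝ) ≤ _)]
    have h3 : ∀ j : ℕ, (1 : ℝ) + 3 * j ≤ 3 * 2 ^ j := by
      intro j
      induction j with
      | zero => norm_num
      | succ j ih =>
        have : (1 : ℝ) ≤ 2 ^ j := one_le_pow₀ (by norm_num)
        rw [pow_succ]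
        push_cast
        linarith
    have h4 : 1 + Real.log ((n : ℝ) / (16 ^ i : ℕ)) ≤ L * (3 * 2 ^ (q - i)) := by
      have h5 := h3 (q - i)
      have h6 : (0 : ℝ) ≤ (q - i : ℕ) := Nat.cast_nonneg _
      nlinarith
    have h7 : (((Finset.univ.filter fun d : ZMod n => 16 ^ i ≤ addOrderOf d).card : ℕ) : ℝ) ≤
        12 * 2 ^ (q - i) * 16 ^ q := by
      refine hcount.trans ?_
      calc 4 * Φ * (1 + Real.log ((n : ℝ) / (16 ^ i : ℕ)))
          ≤ 4 * Φ * (L * (3 * 2 ^ (q - i))) := by gcongr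
        _ = 12 * 2 ^ (q - i) * (Φ * L) := by ring
        _ ≤ _ := by gcongr
    rw [div_le_iff₀ (by positivity)]
    refine h7.trans (le_of_eq ?_)
    have h8 : (16 : ℝ) ^ q * 16 ^ (i - q) = 16 ^ (q - i) * 16 ^ i := by
      rw [← pow_add, ← pow_add]; congr 1; omega
    have h9 : (1 / 16 : ℝ) ^ (i - q) * 16 ^ (i - q) = 1 := by
      rw [← mul_pow]; norm_num
    calc (12 * 2 ^ (q - i) * 16 ^ q : ℝ)
        = 12 * 2 ^ (q - i) * (1 / 16) ^ (i - q) * (16 ^ q * 16 ^ (i - q)) := by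
          linear_combination (-(12 * 2 ^ (q - i) * 16 ^ q) : ℝ) * h9
      _ = _ := by
          rw [h8, show (32 : ℝ) = 2 * 16 by norm_num, mul_pow]; ring
  · rw [Finset.filter_false_of_mem, Finset.card_empty]
    · simp only [Nat.cast_zero, zero_div]
      positivity
    · intro d _ hd
      have := Nat.le_of_dvd (by rw [ZMod.card]; exact NeZero.pos n) (addOrderOf_dvd_card (x := d))
      rw [ZMod.card] at this
      omega

/-- The ratio `v` is `10^(-8) * 2^(-j)` at `i = q - j` and `10^(-8) * 8^k` at `i = q + k`. So `v ^
6` beats the count `32 ^ j`, and `v` loses to `16 ^ k`, leaving a factor 1/2 per level either way.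
The constant `10^8` makes `200000 * 12 / 10^8 ≤ 1/40`. -/
theorem level_cost_le {q : ℕ}
    (hq : (Nat.totient n : ℝ) * (1 + Real.log ((n : ℝ) / Nat.totient n)) ≤ 16 ^ q) (i : ℕ) :
    200000 * min (4 ^ i / (10 ^ 8 * 4 ^ q * scaleWeight q i))
        ((4 ^ i / (10 ^ 8 * 4 ^ q * scaleWeight q i)) ^ 6) *
      ((((Finset.univ.filter fun d : ZMod n => 16 ^ i ≤ addOrderOf d).card : ℕ) : ℝ) / 16 ^ i) ≤
      1 / 40 * scaleWeight q i := by
  have hN := card_addOrderOf_ge_div_le hq i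
  set v : ℝ := 4 ^ i / (10 ^ 8 * 4 ^ q * scaleWeight q i) with hv
  have hvpos : 0 < v := by
    have := scaleWeight_pos q i
    positivity
  have hmin : 0 ≤ min v (v ^ 6) := by positivity
  refine (mul_le_mul_of_nonneg_left hN (by positivity)).trans ?_
  rcases le_total i q with h | h
  · obtain ⟨j, rfl⟩ := Nat.exists_eq_add_of_le h
    have hw : scaleWeight (i + j) i = (1 / 2) ^ j := by
      unfold scaleWeight
      congr 1
      omega
    have hv' : v = 1 / 10 ^ 8 * (1 / 2) ^ j := by
      rw [hv, hw, pow_add]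
      field_simp
      rw [← pow_mul, mul_comm j 2, pow_mul, ← mul_pow]
      norm_num
    rw [hw, Nat.add_sub_cancel_left, Nat.sub_eq_zero_of_le h, pow_zero, mul_one]
    calc _ ≤ 200000 * v ^ 6 * (12 * 32 ^ j) := by gcongr; exact min_le_right _ _
      _ = 200000 * 12 * (1 / 10 ^ 8) ^ 6 * (((1 / 2) ^ 6 * 32) ^ j) := by
          rw [hv', mul_pow, mul_pow, ← pow_mul, ← pow_mul, mul_comm j 6]; ring
      _ ≤ _ := by
          rw [show ((1 / 2 : ℝ) ^ 6 * 32) = 1 / 2 by norm_num]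
          refine mul_le_mul_of_nonneg_right (by norm_num) (by positivity)
  · obtain ⟨k, rfl⟩ := Nat.exists_eq_add_of_le h
    have hw : scaleWeight q (q + k) = (1 / 2) ^ k := by
      unfold scaleWeight
      congr 1
      omega
    have hv' : v = 1 / 10 ^ 8 * 8 ^ k := by
      rw [hv, hw, pow_add]
      field_simp
      rw [← mul_pow]
      norm_num
    rw [hw, Nat.add_sub_cancel_left, Nat.sub_eq_zero_of_le h, pow_zero, mul_one]
    calc _ ≤ 200000 * v * (12 * (1 / 16) ^ k) := by gcongr; exact min_le_left _ _
      _ = 200000 * 12 * (1 / 10 ^ 8) * ((8 * (1 / 16)) ^ k) := by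
          rw [hv', mul_pow]; ring
      _ ≤ _ := by
          rw [show ((8 : ℝ) * (1 / 16)) = 1 / 2 by norm_num]
          refine mul_le_mul_of_nonneg_right (by norm_num) (by positivity)

end Scale

/-! ### Iteration over scales and the final bound. -/

open Finset in
/-- Iterating partial colourings: `27` rounds reduce the size of the uncoloured set by a
factor of `16`. -/
theorem exists_coloring_of_partial {α : Type*} [DecidableEq α]
    (ℱ : Set (Finset α)) (D : ℕ → ℝ) (hD : ∀ I, 0 ≤ D I)
    (hpartial : ∀ I (X : Finset α), 16 ≤ #X → #X < 16 ^ (I + 1) →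
      ∃ ψ : α → ℤ, (∀ x, ψ x = 0 ∨ ψ x = 1 ∨ ψ x = -1) ∧ (∀ x, x ∉ X → ψ x = 0) ∧
        #X ≤ 10 * #{x ∈ X | ψ x ≠ 0} ∧ ∀ A ∈ ℱ, |((∑ x ∈ A, ψ x : ℤ) : ℝ)| ≤ D I)
    (I : ℕ) (X : Finset α) (hX : #X < 16 ^ (I + 1)) :
    ∃ χ : α → ℤ, (∀ x ∈ X, χ x = 1 ∨ χ x = -1) ∧ (∀ x, x ∉ X → χ x = 0) ∧
      ∀ A ∈ ℱ, |((∑ x ∈ A, χ x : ℤ) : ℝ)| ≤ 16 + 27 * ∑ i ∈ range (I + 1), D i := by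
  have hsmall : ∀ X : Finset α, #X < 16 → ∀ b : ℝ, 0 ≤ b →
      ∃ χ : α → ℤ, (∀ x ∈ X, χ x = 1 ∨ χ x = -1) ∧ (∀ x, x ∉ X → χ x = 0) ∧
        ∀ A ∈ ℱ, |((∑ x ∈ A, χ x : ℤ) : ℝ)| ≤ 16 + b := by
    intro X hX b hb
    refine ⟨fun x => if x ∈ X then 1 else 0, fun x hx => by simp [hx], fun x hx => by simp [hx],
      fun A _ => ?_⟩
    have h1 : ((#(A ∩ X) : ℕ) : ℝ) ≤ 16 := by
      exact_mod_cast (card_le_card inter_subset_right).trans hX.le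
    rw [sum_ite_mem, sum_const, nsmul_eq_mul, mul_one]
    simp only [Int.cast_natCast, Nat.abs_cast]
    linarith
  induction I generalizing X with
  | zero => exact hsmall X (by simpa using hX) _ (by simpa using hD 0)
  | succ I ih =>
    have hG : 0 ≤ 27 * ∑ i ∈ range (I + 1), D i :=
      mul_nonneg (by norm_num) (sum_nonneg fun i _ => hD i)
    have hrounds : ∀ k : ℕ, ∀ X : Finset α, #X < 16 ^ (I + 2) →
        #X * 9 ^ k < 16 ^ (I + 1) * 10 ^ k →
        ∃ χ : α → ℤ, (∀ x ∈ X, χ x = 1 ∨ χ x = -1) ∧ (∀ x, x ∉ X → χ x = 0) ∧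
          ∀ A ∈ ℱ, |((∑ x ∈ A, χ x : ℤ) : ℝ)| ≤
            16 + (27 * ∑ i ∈ range (I + 1), D i + k * D (I + 1)) := by
      intro k
      induction k with
      | zero =>
        intro X _ hX
        simpa using ih X (by simpa using hX)
      | succ k ihk =>
        intro X hX hXk
        have hDI := hD (I + 1)
        rcases lt_or_ge (#X) 16 with hlt | hge
        · exact hsmall X hlt _ (by positivity)
        obtain ⟨ψ, hψ, hψX, hψm, hψD⟩ := hpartial (I + 1) X hge hX
        have hcard : #{x ∈ X | ψ x ≠ 0} + #{x ∈ X | ¬ ψ x ≠ 0} = #X :=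
          card_filter_add_card_filter_not _
        obtain ⟨χ, hχ, hχX, hχD⟩ := ihk {x ∈ X | ¬ ψ x ≠ 0} (by omega) (by
          have h1 : 10 * #{x ∈ X | ¬ ψ x ≠ 0} ≤ 9 * #X := by omega
          have h2 := Nat.mul_le_mul_right (9 ^ k) h1
          rw [pow_succ 9, pow_succ 10] at hXk
          nlinarith)
        refine ⟨fun x => ψ x + χ x, fun x hx => ?_, fun x hx => ?_, fun A hA => ?_⟩
        · by_cases h0 : ψ x = 0
          · have := hχ x (by simp [hx, h0])
            simpa [h0] using this
          · have := hχX x (by simp [h0])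
            have h1 := hψ x
            simp only [this, add_zero]
            tauto
        · simp [hψX x hx, hχX x (by simp [hx])]
        · rw [sum_add_distrib, Int.cast_add]
          refine (abs_add_le _ _).trans ?_
          have h1 := hψD A hA
          have h2 := hχD A hA
          push_cast at h1 h2 ⊢
          linarith
    -- The number of rounds comes from `(9/10)^27 < 1/16`.
    obtain ⟨χ, h1, h2, h3⟩ := hrounds 27 X hX (by
      have h4 : 0 < 16 ^ (I + 1) := by positivity
      rw [pow_succ] at hX
      omega)
    refine ⟨χ, h1, h2, fun A hA => (h3 A hA).trans (le_of_eq ?_)⟩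
    rw [sum_range_succ _ (I + 1)]
    push_cast
    ring

open Finset in
theorem herdisc_le_of_forall_exists {Ω : Type*} [Fintype Ω] [DecidableEq Ω]
    (𝒜 : Finset (Finset Ω)) {b : ℝ} (hb : 0 ≤ b)
    (h : ∀ X : Finset Ω, ∃ χ : Ω → ℤ, (∀ x ∈ X, χ x = 1 ∨ χ x = -1) ∧ (∀ x, x ∉ X → χ x = 0) ∧
      ∀ A ∈ 𝒜, |((∑ x ∈ A, χ x : ℤ) : ℝ)| ≤ b) :
    (herdisc 𝒜 : ℝ) ≤ b := by
  rw [← Nat.le_floor_iff hb]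
  refine Finset.sup_le fun X _ => ?_
  obtain ⟨χ, hχ, hχX, hχb⟩ := h X
  refine (inf'_le _ (mem_univ (fun x : {x // x ∈ X} => if χ x = 1 then 1 else -1))).trans ?_
  refine Finset.sup_le fun A' hA' => ?_
  obtain ⟨A, hA, rfl⟩ := mem_image.1 hA'
  have hsum : colorSum (fun x : {x // x ∈ X} => if χ x = 1 then (1 : ℤˣ) else -1)
      (A.subtype fun x => x ∈ X) = ∑ x ∈ A, χ x := by
    calc _ = ∑ x ∈ A.subtype (fun x => x ∈ X), χ x := by
          refine sum_congr rfl fun x _ => ?_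
          rcases hχ x x.2 with h | h <;> simp [h]
      _ = ∑ x ∈ A with x ∈ X, χ x := sum_subtype_eq_sum_filter _
      _ = _ := sum_filter_of_ne fun x _ hx => by
          by_contra hxX
          exact hx (hχX x hxX)
  rw [hsum, Nat.le_floor_iff hb, Nat.cast_natAbs, Int.cast_abs]
  exact hχb A hA

open Finset in
theorem herdisc_modAPs_le (n : ℕ) [NeZero n] {q : ℕ}
    (hq : (Nat.totient n : ℝ) * (1 + Real.log ((n : ℝ) / Nat.totient n)) ≤ 16 ^ q) :
    (herdisc (modAPs n) : ℝ) ≤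
      16 + 27 * (45 * 10 ^ 8 * 4 ^ q * (4 + 3 * ((Nat.log 16 n - q : ℕ) : ℝ))) := by
  set D : ℕ → ℝ := fun I =>
    45 * ∑ i ∈ range (I + 1), 10 ^ 8 * 4 ^ q * scaleWeight q i with hDdef
  have hpos : ∀ i, 0 < 10 ^ 8 * 4 ^ q * scaleWeight q i := fun i =>
    mul_pos (by positivity) (scaleWeight_pos q i)
  have hD : ∀ I, 0 ≤ D I := fun I =>
    mul_nonneg (by norm_num) (sum_nonneg fun i _ => (hpos i).le)
  have hround : ∀ I (X : Finset (ZMod n)), 16 ≤ #X → #X < 16 ^ (I + 1) →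
      ∃ ψ : ZMod n → ℤ, (∀ x, ψ x = 0 ∨ ψ x = 1 ∨ ψ x = -1) ∧ (∀ x, x ∉ X → ψ x = 0) ∧
        #X ≤ 10 * #{x ∈ X | ψ x ≠ 0} ∧
        ∀ A ∈ {A | ∃ (a d : ZMod n) (l : ℕ), A = modAP a d l},
          |((∑ x ∈ A, ψ x : ℤ) : ℝ)| ≤ D I := by
    intro I X hX hI
    obtain ⟨ψ, h1, h2, h3, h4⟩ := exists_partial_coloring_modAP X hX hI
      (fun i => 10 ^ 8 * 4 ^ q * scaleWeight q i) hpos (by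
        refine (sum_le_sum fun i _ => level_cost_le hq i).trans ?_
        rw [← mul_sum]
        linarith [sum_scaleWeight_le_three q I])
    refine ⟨ψ, h1, h2, h3, ?_⟩
    rintro A ⟨a, d, l, rfl⟩
    exact h4 a d l
  have hmono : 16 + 27 * ∑ I ∈ range (Nat.log 16 n + 1), D I ≤
      16 + 27 * (45 * 10 ^ 8 * 4 ^ q * (4 + 3 * ((Nat.log 16 n - q : ℕ) : ℝ))) := by
    have h1 : ∑ I ∈ range (Nat.log 16 n + 1), D I = 45 * 10 ^ 8 * 4 ^ q *
        ∑ I ∈ range (Nat.log 16 n + 1), ∑ i ∈ range (I + 1), scaleWeight q i := by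
      simp only [hDdef, ← mul_sum]
      ring
    rw [h1]
    have := sum_sum_scaleWeight_le q (Nat.log 16 n)
    gcongr
  refine le_trans (herdisc_le_of_forall_exists _ ?_ fun X => ?_) hmono
  · have := sum_nonneg fun I (_ : I ∈ range (Nat.log 16 n + 1)) => hD I
    positivity
  · obtain ⟨χ, h1, h2, h3⟩ := exists_coloring_of_partial _ D hD hround (Nat.log 16 n) X (by
      refine lt_of_le_of_lt (card_le_univ X) ?_
      rw [ZMod.card]
      exact Nat.lt_pow_succ_log_self (by norm_num) n)
    refine ⟨χ, h1, h2, fun A hA => h3 A ?_⟩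
    classical
    unfold modAPs at hA
    exact (mem_filter.1 hA).2

theorem exists_pow_sixteen_between {x : ℝ} (hx : 1 ≤ x) :
    ∃ q : ℕ, x ≤ 16 ^ q ∧ (16 : ℝ) ^ q ≤ 16 * x := by
  have hex : ∃ q : ℕ, x ≤ 16 ^ q :=
    (pow_unbounded_of_one_lt x (by norm_num : (1 : ℝ) < 16)).imp fun _ h => h.le
  classical
  refine ⟨Nat.find hex, Nat.find_spec hex, ?_⟩
  rcases h : Nat.find hex with _ | q
  · norm_num
    linarith
  · have := Nat.find_min hex (m := q) (by omega)
    rw [pow_succ]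
    linarith

theorem theorem5p1 :
    ∃ c : ℝ, ∀ (n : ℕ) [NeZero n],
      (herdisc (modAPs n) : ℝ) ≤
        c * (Nat.totient n : ℝ) ^ ((1 : ℝ) / 2) *
          (Real.log (Real.exp 1 * (n : ℝ) / (Nat.totient n : ℝ))) ^ ((3 : ℝ) / 2) := by
  refine ⟨4 * (16 + 27 * (45 * 10 ^ 8 * 7)), fun n _ => ?_⟩
  have hφ := one_le_totient_real n
  have hlog := log_div_totient_nonneg n
  have hn : (0 : ℝ) < n := by exact_mod_cast NeZero.pos n
  have hL : Real.log (Real.exp 1 * (n : ℝ) / (Nat.totient n : ℝ)) =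
      1 + Real.log ((n : ℝ) / Nat.totient n) := by
    rw [mul_div_assoc, Real.log_mul (Real.exp_pos 1).ne' (by positivity), Real.log_exp]
  rw [hL]
  set Φ : ℝ := (Nat.totient n : ℝ)
  set L : ℝ := 1 + Real.log ((n : ℝ) / Φ) with hLdef
  have hL1 : 1 ≤ L := by linarith
  obtain ⟨q, hq1, hq2⟩ := exists_pow_sixteen_between (x := Φ * L) (by nlinarith)
  have hmain := herdisc_modAPs_le n hq1
  -- Since `16 ^ q ≥ Φ`, at most `log (n / Φ) / log 16` scales lie above `q`.
  have hM : ((Nat.log 16 n - q : ℕ) : ℝ) ≤ L := by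
    rcases le_total (Nat.log 16 n) q with h | h
    · rw [Nat.sub_eq_zero_of_le h]
      push_cast
      linarith
    · have h1 : (16 : ℝ) ^ (Nat.log 16 n - q) ≤ n / Φ := by
        have h2 : (16 : ℝ) ^ (Nat.log 16 n) ≤ n := by
          exact_mod_cast Nat.pow_log_le_self 16 (NeZero.ne n)
        have h3 : Φ ≤ 16 ^ q := le_trans (by nlinarith) hq1
        rw [le_div_iff₀ (by linarith)]
        calc (16 : ℝ) ^ (Nat.log 16 n - q) * Φ ≤ 16 ^ (Nat.log 16 n - q) * 16 ^ q := by gcongr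
          _ = 16 ^ (Nat.log 16 n) := by rw [← pow_add, Nat.sub_add_cancel h]
          _ ≤ n := h2
      have h4 := Real.log_le_log (by positivity) h1
      rw [Real.log_pow, show (16 : ℝ) = 2 ^ (4 : ℕ) by norm_num, Real.log_pow] at h4
      push_cast at h4
      nlinarith [Real.log_two_gt_d9, (Nat.cast_nonneg (Nat.log 16 n - q) : (0 : ℝ) ≤ _)]
  have h4q : (4 : ℝ) ^ q ≤ 4 * (Φ ^ ((1 : ℝ) / 2) * L ^ ((1 : ℝ) / 2)) := by
    rw [← Real.mul_rpow (by linarith) (by linarith), ← Real.sqrt_eq_rpow]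
    calc (4 : ℝ) ^ q = √(16 ^ q) := by
          rw [show (16 : ℝ) = 4 ^ 2 by norm_num, ← pow_mul, mul_comm, pow_mul,
            Real.sqrt_sq (by positivity)]
      _ ≤ √(16 * (Φ * L)) := Real.sqrt_le_sqrt hq2
      _ = 4 * √(Φ * L) := by
          rw [Real.sqrt_mul (by norm_num), show (16 : ℝ) = 4 ^ 2 by norm_num,
            Real.sqrt_sq (by norm_num)]
  have h32 : L ^ ((3 : ℝ) / 2) = L ^ ((1 : ℝ) / 2) * L := by
    rw [show (3 : ℝ) / 2 = 1 / 2 + 1 by norm_num, Real.rpow_add (by linarith), Real.rpow_one]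
  have h4q1 : (1 : ℝ) ≤ 4 ^ q := one_le_pow₀ (by norm_num)
  calc (herdisc (modAPs n) : ℝ)
      ≤ 16 + 27 * (45 * 10 ^ 8 * 4 ^ q * (4 + 3 * ((Nat.log 16 n - q : ℕ) : ℝ))) := hmain
    _ ≤ 16 * (4 ^ q * L) + 27 * (45 * 10 ^ 8 * 4 ^ q * (4 * L + 3 * L)) := by
        have h5 : (1 : ℝ) ≤ 4 ^ q * L := one_le_mul_of_one_le_of_one_le h4q1 hL1
        have h6 : 4 + 3 * ((Nat.log 16 n - q : ℕ) : ℝ) ≤ 4 * L + 3 * L := by linarith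
        have h7 : 45 * 10 ^ 8 * 4 ^ q * (4 + 3 * ((Nat.log 16 n - q : ℕ) : ℝ)) ≤
            45 * 10 ^ 8 * 4 ^ q * (4 * L + 3 * L) := by gcongr
        linarith
    _ = (16 + 27 * (45 * 10 ^ 8 * 7)) * L * 4 ^ q := by ring
    _ ≤ (16 + 27 * (45 * 10 ^ 8 * 7)) * L * (4 * (Φ ^ ((1 : ℝ) / 2) * L ^ ((1 : ℝ) / 2))) := by
        gcongr
    _ = _ := by rw [h32]; ring
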